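/- **Theorem 3.1.** Let $l>0$, $\sigma>0$, $D_1,D_2\ge 0$ and $I=(-l,l)$. Put $$W(t)=8D_2\sin^8\tfrac t2+4(1+\sigma)\sin^4\tfrac t2-4\sigma\sin^2\tfrac t2+a_0 ,$$ where the constant $a_0$ is chosen so that $\min_{\mathbb R} W=0$. Then $W\ge 0$ has exactly two zeros in $[-\pi,\pi]$, of the form $\pm\beta$ with $\beta>0$; put $\Phi(s)=2\int_{-\beta}^s\sqrt{W(t)}\,dt$. Let $\mathcal Y_C$ be the set of all $(\theta,g)\in W^{1,2}(I)\times W^{2,2}(I)$ with $|\theta|\le\pi$ a.e., $\theta(-l)=\theta(l)$, $g(-l)=g(l)$ and $g'(-l)=g'(l)$. For $\varepsilon>0$ let $$G^C_\varepsilon(\theta,g)=\int_I\Big[D_1\varepsilon(g''+\cos\theta\,\theta')^2+\frac{D_2}{2\varepsilon}(g'+\sin\theta)^4+\frac1\varepsilon(g'+\sin\theta)^2+\frac{4D_2}{\varepsilon}(g'+\sin\theta)^2\sin^4\frac\theta2+\varepsilon\,\theta'^2+\frac1\varepsilon W(\theta)\Big]dx$$ for $(\theta,g)\in\mathcal Y_C$,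 and $G^C_\varepsilon(\theta,g)=+\infty$ otherwise. Let $\mathcal A_C$ be the set of all $(\theta,g)$ with $\theta\in BV(I;\{\pm\beta\})$, $g\in W^{1,2}(I)$, $g'\in BV(I)$, $g'+\sin\theta=0$ a.e. in $I$ and $\int_I\theta=0$. Let $$G^C_0(\theta,g)=\int_I|(\Phi\circ\theta)'|+|\Phi(\tilde\theta(l))-\Phi(\tilde\theta(-l))|$$ for $(\theta,g)\in\mathcal A_C$, where $\int_I|(\Phi\circ\theta)'|$ is the total variation and $\tilde\theta(\pm l)$ are the traces of $\theta$ at $\pm l$, and $G^C_0(\theta,g)=+\infty$ otherwise. Let $\varepsilon_j>0$, $\varepsilon_j\to0$, and let $(\theta_j,g_j)\in\mathcal Y_C$ be a minimizer of $G^C_{\varepsilon_j}$ for each $j$. Then there are $g\in W^{1,2}(I)$ and sequences $\{a_j\}\subset\{\pm1\}$, $\{c_j\}\subset(-l,l)$ such that $$(\hat\theta_j,\hat g_j)\to(\theta,g)\quad\text{in }L^1(I)\times L^2(I),$$ where, with $\theta_j$, $g_j$ extended $2l$-periodically, $$\hat\theta_j(x)=a_j\,\theta_j(x+c_j),\qquad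 \hat g_j(x)=a_j\Big(g_j(x+c_j)-\frac1{2l}\int_I g_j\Big),$$ and $\theta=\beta$ on $J=(-l/2,l/2)$, $\theta=-\beta$ on $I\setminus J$. Furthermore $(\theta,g)\in\mathcal A_C$ and $G^C_0(\theta,g)=2\Phi(\beta)$. -/

import Mathlib

open Set Filter Topology MeasureTheory
open scoped ContDiff ENNReal

noncomputable section

namespace ChenLubensky

/-! Function spaces on the interval `I = (-l, l)`. Functions are total functions `ℝ → ℝ`; every notion
below depends only on their a.e. class on `I`. -/

/-- The interval `I = (-l, l)`. -/
def I (l : ℝ) : Set ℝ := Ioo (-l) l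

/-- `v` is the weak (distributional) derivative of `u` on `I`. -/
def IsWeakDeriv (l : ℝ) (u v : ℝ → ℝ) : Prop :=
  ∀ φ : ℝ → ℝ, ContDiff ℝ ∞ φ → HasCompactSupport φ → tsupport φ ⊆ I l →
    ∫ x in I l, u x * deriv φ x = -∫ x in I l, v x * φ x

open Classical in
/-- The weak derivative of `u` on `I` (a representative of it), if `u` has an integrable one;
it is then unique up to a.e. equality on `I`. -/
def weakDeriv (l : ℝ) (u : ℝ → ℝ) : ℝ → ℝ :=
  if h : ∃ v : ℝ → ℝ, IntegrableOn v (I l) ∧ IsWeakDeriv l u v then h.choose else 0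

/-- `u ∈ L^p(I)`. -/
def MemL (l : ℝ) (p : ℝ≥0∞) (u : ℝ → ℝ) : Prop := MemLp u p (volume.restrict (I l))

/-- `u ∈ W^{1,2}(I)`. -/
def MemW12 (l : ℝ) (u : ℝ → ℝ) : Prop :=
  MemL l 2 u ∧ ∃ v : ℝ → ℝ, MemL l 2 v ∧ IsWeakDeriv l u v

/-- `u ∈ W^{2,2}(I)`. -/
def MemW22 (l : ℝ) (u : ℝ → ℝ) : Prop := MemW12 l u ∧ MemW12 l (weakDeriv l u)

/-- The total variation `∫_I |u'|` of the distributional derivative of `u`: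
the supremum of `∫_I u φ'` over `φ ∈ C¹_c(I)` with `|φ| ≤ 1`. -/
def totalVar (l : ℝ) (u : ℝ → ℝ) : ℝ≥0∞ :=
  ⨆ φ ∈ {φ : ℝ → ℝ | ContDiff ℝ 1 φ ∧ HasCompactSupport φ ∧ tsupport φ ⊆ I l ∧ ∀ x, |φ x| ≤ 1},
    ENNReal.ofReal (∫ x in I l, u x * deriv φ x)

/-- `u ∈ BV(I)`. -/
def MemBV (l : ℝ) (u : ℝ → ℝ) : Prop := IntegrableOn u (I l) ∧ totalVar l u < ⊤

/-- The trace of `u` at `-l`, the limit of the averages over `(-l, -l + ρ)` as `ρ → 0⁺`.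
It exists for `u` in `BV(I)` or `W^{1,2}(I)`, and for the latter it is the value at `-l` of the
continuous representative. -/
def traceLeft (l : ℝ) (u : ℝ → ℝ) : ℝ :=
  limUnder (𝓝[>] (0 : ℝ)) fun ρ => ρ⁻¹ * ∫ s in (-l)..(-l + ρ), u s

/-- The trace of `u` at `l`, the limit of the averages over `(l - ρ, l)` as `ρ → 0⁺`. -/
def traceRight (l : ℝ) (u : ℝ → ℝ) : ℝ :=
  limUnder (𝓝[>] (0 : ℝ)) fun ρ => ρ⁻¹ * ∫ s in (l - ρ)..l, u s

/-- The `2l`-periodic extension of `u` from `[-l, l)` to `ℝ`. -/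
def perExt (l : ℝ) (u : ℝ → ℝ) (x : ℝ) : ℝ := u (x - 2 * l * (⌊(x + l) / (2 * l)⌋ : ℝ))

/-- The mean of `u` over `I`. -/
def mean (l : ℝ) (u : ℝ → ℝ) : ℝ := (2 * l)⁻¹ * ∫ x in I l, u x

/-! The potential. -/

/-- The potential before the additive normalization. -/
def W₀ (D₂ σ t : ℝ) : ℝ :=
  8 * D₂ * Real.sin (t / 2) ^ 8 + 4 * (1 + σ) * Real.sin (t / 2) ^ 4 - 4 * σ * Real.sin (t / 2) ^ 2

/-- The additive constant which makes the minimum of the potential zero. -/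
def a₀ (D₂ σ : ℝ) : ℝ := -⨅ t : ℝ, W₀ D₂ σ t

/-- The double well potential `W`. -/
def W (D₂ σ t : ℝ) : ℝ := W₀ D₂ σ t + a₀ D₂ σ

/-- The smallest positive zero `β` of `W`. -/
def β (D₂ σ : ℝ) : ℝ := sInf {t : ℝ | 0 < t ∧ W D₂ σ t = 0}

/-- `Φ(s) = 2 ∫_{-β}^s √W`. -/
def Φ (D₂ σ s : ℝ) : ℝ := 2 * ∫ t in (-β D₂ σ)..s, √(W D₂ σ t)

/-! The functionals. -/

/-- The energy `F^C_ε(θ, g)`. -/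
def F (D₁ D₂ σ l ε : ℝ) (θ g : ℝ → ℝ) : ℝ :=
  ∫ x in I l,
    (D₁ * ε * (weakDeriv l (weakDeriv l g) x + Real.cos (θ x) * weakDeriv l θ x) ^ 2
      + D₂ / (2 * ε) * (weakDeriv l g x + Real.sin (θ x)) ^ 4
      + 1 / ε * (weakDeriv l g x + Real.sin (θ x)) ^ 2
      + 4 * D₂ / ε * (weakDeriv l g x + Real.sin (θ x)) ^ 2 * Real.sin (θ x / 2) ^ 4
      + ε * weakDeriv l θ x ^ 2
      + 1 / ε * W D₂ σ (θ x))

/-- The admissible class `𝒴_C`: `θ ∈ W^{1,2}(I)` an angle with values in `[-π, π]`, `g ∈ W^{2,2}(I)`,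
and `θ`, `g`, `g'` take equal values at the two end points. -/
def MemY (l : ℝ) (θ g : ℝ → ℝ) : Prop :=
  MemW12 l θ ∧ MemW22 l g ∧ (∀ᵐ x ∂volume.restrict (I l), |θ x| ≤ Real.pi) ∧
    traceLeft l θ = traceRight l θ ∧ traceLeft l g = traceRight l g ∧
    traceLeft l (weakDeriv l g) = traceRight l (weakDeriv l g)

open Classical in
/-- The functional `G^C_ε`, which is `F^C_ε` on `𝒴_C` and `+∞` elsewhere. -/
def G (D₁ D₂ σ l ε : ℝ) (θ g : ℝ → ℝ) : EReal :=
  if MemY l θ g then ((F D₁ D₂ σ l ε θ g : ℝ) : EReal) else ⊤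

/-- `(θ, g) ∈ 𝒴_C` is a minimizer of `G^C_ε`. -/
def IsMinimizer (D₁ D₂ σ l ε : ℝ) (θ g : ℝ → ℝ) : Prop :=
  MemY l θ g ∧ ∀ θ' g' : ℝ → ℝ, G D₁ D₂ σ l ε θ g ≤ G D₁ D₂ σ l ε θ' g'

/-- The class `𝒜_C`: `θ ∈ BV(I; {±β})`, `g ∈ W^{1,2}(I)`, `g' ∈ BV(I)`, `g' + sin θ = 0` a.e.,
and `∫_I θ = 0`. -/
def MemA (D₂ σ l : ℝ) (θ g : ℝ → ℝ) : Prop :=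
  MemBV l θ ∧ (∀ᵐ x ∂volume.restrict (I l), θ x = β D₂ σ ∨ θ x = -β D₂ σ) ∧
    MemW12 l g ∧ MemBV l (weakDeriv l g) ∧
    (∀ᵐ x ∂volume.restrict (I l), weakDeriv l g x + Real.sin (θ x) = 0) ∧
    ∫ x in I l, θ x = 0

open Classical in
/-- The limit functional `G^C_0`, with values in `[0, ∞]`. -/
def G₀ (D₂ σ l : ℝ) (θ g : ℝ → ℝ) : ℝ≥0∞ :=
  if MemA D₂ σ l θ g then
    totalVar l (fun x => Φ D₂ σ (θ x)) +
      ENNReal.ofReal |Φ D₂ σ (traceRight l θ) - Φ D₂ σ (traceLeft l θ)|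
  else ⊤

/-- The limit profile: `b` on `(-l/2, l/2)` and `-b` elsewhere. -/
def chevron (l b : ℝ) (x : ℝ) : ℝ := if x ∈ Ioo (-l / 2) (l / 2) then b else -b

end ChenLubensky

end

namespace ChenLubensky

lemma locallyIntegrable_of_intervalIntegrable {v : ℝ → ℝ}
    (hi : ∀ a b, IntervalIntegrable v volume a b) :
    LocallyIntegrable v volume := by
  rw [locallyIntegrable_iff]
  intro k hk
  obtain ⟨r, hr⟩ := hk.isBounded.subset_closedBall 0
  refine IntegrableOn.mono_set ?_ (hr.trans (by rw [Real.closedBall_eq_Icc]))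
  rcases le_or_gt 0 r with h0 | h0
  · exact (intervalIntegrable_iff_integrableOn_Icc_of_le (by linarith)).1 (hi (0 - r) (0 + r))
  · rw [Icc_eq_empty (by linarith)]; exact integrableOn_empty

/-- `U` is a primitive of the locally integrable function `V`. -/
structure IsPrim (U V : ℝ → ℝ) : Prop where
  locInt : LocallyIntegrable V volume
  sub_eq : ∀ x y, U y - U x = ∫ t in x..y, V t

namespace IsPrim

variable {U V : ℝ → ℝ}

lemma intInt (h : IsPrim U V) (a b : ℝ) : IntervalIntegrable V volume a b :=
  (h.locInt.integrableOn_isCompact isCompact_uIcc).intervalIntegrable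

lemma eq_add (h : IsPrim U V) (a : ℝ) : U = fun x => U a + ∫ t in a..x, V t := by
  funext x
  rw [← h.sub_eq]; ring

lemma ae_hasDerivAt (h : IsPrim U V) : ∀ᵐ x, HasDerivAt U (V x) x := by
  filter_upwards [LocallyIntegrable.ae_hasDerivAt_integral h.locInt] with x hx
  rw [h.eq_add 0]
  exact (hx 0).const_add _

lemma ac (h : IsPrim U V) (a b : ℝ) : AbsolutelyContinuousOnInterval U a b := by
  rw [h.eq_add a]
  have h1 := (h.intInt a b).absolutelyContinuousOnInterval_intervalIntegral
    (c := a) left_mem_uIcc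
  have h2 : AbsolutelyContinuousOnInterval (fun _ : ℝ => U a) a b :=
    contDiffOn_const.absolutelyContinuousOnInterval
  exact h2.add h1

lemma continuous (h : IsPrim U V) : Continuous U := by
  rw [h.eq_add 0]
  exact continuous_const.add (intervalIntegral.continuous_primitive h.intInt 0)

lemma of_ac (hU : ∀ a b, AbsolutelyContinuousOnInterval U a b)
    (hV : ∀ᵐ x, HasDerivAt U (V x) x) : IsPrim U V := by
  have hd : deriv U =ᵐ[volume] V := by
    filter_upwards [hV] with x hx using hx.deriv
  have hi : ∀ a b, IntervalIntegrable V volume a b := fun a b =>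
    (hU a b).intervalIntegrable_deriv.congr_ae (ae_restrict_of_ae hd)
  refine ⟨?_, fun x y => ?_⟩
  · exact locallyIntegrable_of_intervalIntegrable hi
  · rw [← (hU x y).integral_deriv_eq_sub]
    exact intervalIntegral.integral_congr_ae (by
      filter_upwards [hd] with t ht _ using ht)

lemma of_lipschitz {K : NNReal} (hU : LipschitzWith K U) (hV : ∀ᵐ x, HasDerivAt U (V x) x) :
    IsPrim U V :=
  of_ac (fun _ _ => hU.lipschitzOnWith.absolutelyContinuousOnInterval) hV

lemma congr_ae {V' : ℝ → ℝ} (h : IsPrim U V) (hV : V =ᵐ[volume] V') : IsPrim U V' := by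
  refine of_ac h.ac ?_
  filter_upwards [h.ae_hasDerivAt, hV] with x hx hx' using hx' ▸ hx

end IsPrim

lemma _root_.LipschitzOnWith.comp_absolutelyContinuousOnInterval {f u : ℝ → ℝ} {s : Set ℝ}
    {K : NNReal} {a b : ℝ} (hf : LipschitzOnWith K f s)
    (hu : AbsolutelyContinuousOnInterval u a b) (hs : MapsTo u (uIcc a b) s) :
    AbsolutelyContinuousOnInterval (f ∘ u) a b := by
  rw [absolutelyContinuousOnInterval_iff] at hu ⊢
  intro ε hε
  obtain ⟨δ, hδ, h⟩ := hu (ε / (K + 1)) (by positivity)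
  refine ⟨δ, hδ, fun E hE hlt => ?_⟩
  have h1 := h E hE hlt
  have h2 : ∑ i ∈ Finset.range E.1, dist ((f ∘ u) (E.2 i).1) ((f ∘ u) (E.2 i).2) ≤
      ∑ i ∈ Finset.range E.1, K * dist (u (E.2 i).1) (u (E.2 i).2) := by
    refine Finset.sum_le_sum fun i hi => ?_
    exact hf.dist_le_mul _ (hs (hE.1 i hi).1) _ (hs (hE.1 i hi).2)
  rw [← Finset.mul_sum] at h2
  rw [lt_div_iff₀ (by positivity)] at h1
  have h3 : 0 ≤ ∑ i ∈ Finset.range E.1, dist (u (E.2 i).1) (u (E.2 i).2) :=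
    Finset.sum_nonneg fun _ _ => dist_nonneg
  nlinarith

/-- Chain rule for a `C¹` function of an absolutely continuous one. -/
lemma IsPrim.comp {U V f f' : ℝ → ℝ} (h : IsPrim U V) (hf : ∀ t, HasDerivAt f (f' t) t)
    (hf' : Continuous f') : IsPrim (fun x => f (U x)) (fun x => f' (U x) * V x) := by
  refine of_ac (fun a b => ?_) ?_
  · obtain ⟨r, hr⟩ := ((isCompact_uIcc (a := a) (b := b)).image h.continuous).isBounded.subset_closedBall 0
    obtain ⟨C, hC⟩ := (isCompact_closedBall (0 : ℝ) r).exists_bound_of_continuousOn hf'.continuousOn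
    have hL : LipschitzOnWith C.toNNReal f (Metric.closedBall 0 r) := by
      refine (convex_closedBall (0 : ℝ) r).lipschitzOnWith_of_nnnorm_hasDerivWithin_le
        (fun t _ => (hf t).hasDerivWithinAt) fun t ht => ?_
      have := hC t ht
      rw [← NNReal.coe_le_coe, coe_nnnorm]
      exact this.trans (Real.le_coe_toNNReal C)
    exact hL.comp_absolutelyContinuousOnInterval (h.ac a b)
      fun x hx => hr (mem_image_of_mem U hx)
  · filter_upwards [h.ae_hasDerivAt] with x hx
    exact (hf (U x)).comp x hx

/-! ### Weak derivatives -/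

section
variable {l : ℝ} {u v : ℝ → ℝ}

lemma setIntegral_I (hl : 0 < l) (f : ℝ → ℝ) : ∫ x in I l, f x = ∫ x in (-l)..l, f x := by
  rw [intervalIntegral.integral_of_le (by linarith), I, integral_Ioc_eq_integral_Ioo]

lemma integrableOn_I (hl : 0 < l) {f : ℝ → ℝ} :
    IntegrableOn f (I l) ↔ IntervalIntegrable f volume (-l) l := by
  rw [intervalIntegrable_iff_integrableOn_Ioo_of_le (by linarith), I]

/-- Compact subsets of `I` stay away from the end points. -/
lemma exists_subset_Icc_of_isCompact {K : Set ℝ} (hl : 0 < l) (hK : IsCompact K) (hKI : K ⊆ I l) :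
    ∃ r, 0 < r ∧ r < l ∧ K ⊆ Icc (-r) r := by
  rcases K.eq_empty_or_nonempty with rfl | hne
  · exact ⟨l / 2, by linarith, by linarith, empty_subset _⟩
  obtain ⟨x, hx, hmax⟩ := hK.exists_isMaxOn hne continuous_abs.continuousOn
  have hxl : |x| < l := abs_lt.2 (hKI hx)
  refine ⟨max |x| (l / 2), lt_max_of_lt_right (by linarith), max_lt hxl (by linarith), fun y hy => ?_⟩
  exact abs_le.1 ((hmax hy).trans (le_max_left _ _))

lemma isWeakDeriv_of_isPrim (hl : 0 < l) {U V : ℝ → ℝ} (h : IsPrim U V) : IsWeakDeriv l U V := by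
  intro φ hφ hc hs
  obtain ⟨r, hr0, hr, hK⟩ := exists_subset_Icc_of_isCompact hl hc hs
  have hz : ∀ x, r < |x| → φ x = 0 := fun x hx => image_eq_zero_of_notMem_tsupport fun hx' =>
    absurd (abs_le.2 (hK hx')) (not_le.2 hx)
  have h1 := (h.ac (-l) l).integral_mul_deriv_eq_deriv_mul
    (hφ.of_le (by exact_mod_cast le_top) : ContDiff ℝ 1 φ).contDiffOn.absolutelyContinuousOnInterval
  rw [hz l (by rwa [abs_of_pos hl]), hz (-l) (by rwa [abs_neg, abs_of_pos hl])] at h1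
  rw [setIntegral_I hl, setIntegral_I hl, h1]
  simp only [mul_zero, sub_zero, zero_sub, neg_inj]
  refine intervalIntegral.integral_congr_ae ?_
  filter_upwards [h.ae_hasDerivAt] with x hx _
  rw [hx.deriv]

lemma IsWeakDeriv.congr {u' v' : ℝ → ℝ} (h : IsWeakDeriv l u v)
    (hu : u =ᵐ[volume.restrict (I l)] u') (hv : v =ᵐ[volume.restrict (I l)] v') :
    IsWeakDeriv l u' v' := by
  intro φ h1 h2 h3
  have e1 : ∫ x in I l, u x * deriv φ x = ∫ x in I l, u' x * deriv φ x :=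
    integral_congr_ae (hu.mul (ae_eq_refl _))
  have e2 : ∫ x in I l, v x * φ x = ∫ x in I l, v' x * φ x :=
    integral_congr_ae (hv.mul (ae_eq_refl _))
  rw [← e1, ← e2]
  exact h φ h1 h2 h3

/-- Extension by zero gives a primitive on the whole line. -/
lemma isPrim_indicator (hv : IntegrableOn v (I l)) (c : ℝ) :
    IsPrim (fun x => c + ∫ t in (-l)..x, (I l).indicator v t) ((I l).indicator v) := by
  have hi : Integrable ((I l).indicator v) := (integrable_indicator_iff measurableSet_Ioo).2 hv
  refine ⟨hi.locallyIntegrable, fun x y => ?_⟩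
  rw [add_sub_add_left_eq_sub, intervalIntegral.integral_interval_sub_left
    hi.intervalIntegrable hi.intervalIntegrable]

lemma indicator_ae_eq : (I l).indicator v =ᵐ[volume.restrict (I l)] v := by
  filter_upwards [ae_restrict_mem (measurableSet_Ioo : MeasurableSet (I l))] with x hx
  exact indicator_of_mem hx v

/-- A test function with vanishing integral is the derivative of a test function. -/
lemma exists_test_primitive (hl : 0 < l) {ζ : ℝ → ℝ} (hζ : ContDiff ℝ ∞ ζ) (hc : HasCompactSupport ζ)
    (hs : tsupport ζ ⊆ I l) (h0 : ∫ x in I l, ζ x = 0) :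
    ∃ φ : ℝ → ℝ, ContDiff ℝ ∞ φ ∧ HasCompactSupport φ ∧ tsupport φ ⊆ I l ∧ deriv φ = ζ := by
  obtain ⟨r, hr0, hr, hK⟩ := exists_subset_Icc_of_isCompact hl hc hs
  have hz : ∀ x, x ∉ Icc (-r) r → ζ x = 0 := fun x hx => image_eq_zero_of_notMem_tsupport fun hx' =>
    hx (hK hx')
  have hcont := hζ.continuous
  have hd : ∀ x, HasDerivAt (fun x => ∫ t in (-l)..x, ζ t) (ζ x) x := fun x =>
    (hcont.integral_hasStrictDerivAt (-l) x).hasDerivAt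
  have hde : deriv (fun x => ∫ t in (-l)..x, ζ t) = ζ := funext fun x => (hd x).deriv
  have hz0 : ∀ a b, (∀ x ∈ uIcc a b, ζ x = 0) → ∫ t in a..b, ζ t = 0 := fun a b h => by
    rw [intervalIntegral.integral_congr (g := fun _ => 0) h]; simp
  have hsup : ∀ x, x ∉ Icc (-r) r → ∫ t in (-l)..x, ζ t = 0 := by
    intro x hx
    rcases lt_or_ge x (-r) with h | h
    · refine hz0 _ _ fun y hy => hz y fun hy' => ?_
      have := hy.2
      have h3 : max (-l) x < -r := max_lt (by linarith) h
      linarith [hy'.1]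
    · have h' : r < x := by by_contra h3; exact hx ⟨h, not_lt.1 h3⟩
      rw [← intervalIntegral.integral_add_adjacent_intervals (b := l)
        (hcont.intervalIntegrable _ _) (hcont.intervalIntegrable _ _), ← setIntegral_I hl, h0,
        zero_add]
      refine hz0 _ _ fun y hy => hz y fun hy' => ?_
      have := hy.1
      have h3 : r < min l x := lt_min hr h'
      linarith [hy'.2]
  have hss : Function.support (fun x => ∫ t in (-l)..x, ζ t) ⊆ Icc (-r) r := fun x hx => by
    by_contra h; exact hx (hsup x h)
  have hts : tsupport (fun x => ∫ t in (-l)..x, ζ t) ⊆ Icc (-r) r :=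
    closure_minimal hss isClosed_Icc
  refine ⟨fun x => ∫ t in (-l)..x, ζ t, ?_, ?_, ?_, hde⟩
  · rw [contDiff_infty_iff_deriv, hde]
    exact ⟨fun x => (hd x).differentiableAt, hζ⟩
  · exact isCompact_Icc.of_isClosed_subset (isClosed_tsupport _) hts
  · exact hts.trans (Icc_subset_Ioo (by linarith) hr)

/-- du Bois-Reymond's lemma. -/
lemma ae_const_of_isWeakDeriv_zero (hl : 0 < l) (hu : IntegrableOn u (I l))
    (h : IsWeakDeriv l u 0) : ∃ c, u =ᵐ[volume.restrict (I l)] fun _ => c := by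
  let b : ContDiffBump (0 : ℝ) := ⟨l / 4, l / 2, by linarith, by linarith⟩
  set ψ := b.normed volume with hψ
  have hψs : ContDiff ℝ ∞ ψ := b.contDiff_normed
  have hψc : HasCompactSupport ψ := b.hasCompactSupport_normed
  have hψt : tsupport ψ ⊆ I l := by
    rw [hψ, b.tsupport_normed_eq, Real.closedBall_eq_Icc]
    exact Icc_subset_Ioo (by simp [b]; linarith) (by simp [b]; linarith)
  have hset : ∀ ζ : ℝ → ℝ, tsupport ζ ⊆ I l → ∫ x in I l, ζ x = ∫ x, ζ x := fun ζ hζ =>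
    setIntegral_eq_integral_of_forall_compl_eq_zero fun x hx =>
      image_eq_zero_of_notMem_tsupport fun h' => hx (hζ h')
  have hψ1 : ∫ x in I l, ψ x = 1 := by rw [hset ψ hψt]; exact b.integral_normed
  have hint : ∀ ζ : ℝ → ℝ, Continuous ζ → HasCompactSupport ζ → IntegrableOn (fun x => u x * ζ x) (I l) := by
    intro ζ h1 h2
    obtain ⟨C, hC⟩ := h2.exists_bound_of_continuous h1
    exact hu.mul_bdd (c := C) h1.aestronglyMeasurable (ae_of_all _ hC)
  refine ⟨∫ x in I l, u x * ψ x, ?_⟩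
  set c := ∫ x in I l, u x * ψ x with hcdef
  have key := (isOpen_Ioo : IsOpen (I l)).ae_eq_zero_of_integral_contDiff_smul_eq_zero (μ := volume)
    (f := fun x => u x - c) ?_ ?_
  · refine (ae_restrict_iff' (measurableSet_Ioo : MeasurableSet (I l))).2 ?_
    filter_upwards [key] with x hx hxI using sub_eq_zero.1 (hx hxI)
  · refine (IntegrableOn.sub hu ?_).locallyIntegrableOn
    exact integrableOn_const (by simp [I])
  · intro φ h1 h2 h3
    set m := ∫ x in I l, φ x with hm
    have hφi : Integrable φ (volume.restrict (I l)) :=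
      (h1.continuous.integrable_of_hasCompactSupport h2).integrableOn
    have hψi : Integrable ψ (volume.restrict (I l)) :=
      (hψs.continuous.integrable_of_hasCompactSupport hψc).integrableOn
    have hsub : tsupport (fun x => φ x - m * ψ x) ⊆ tsupport φ ∪ tsupport ψ := by
      refine closure_minimal (fun x hx => ?_) ((isClosed_tsupport _).union (isClosed_tsupport _))
      by_contra hn
      rw [mem_union, not_or] at hn
      apply hx
      simp [image_eq_zero_of_notMem_tsupport hn.1, image_eq_zero_of_notMem_tsupport hn.2]
    obtain ⟨η, e1, e2, e3, e4⟩ := exists_test_primitive hl (ζ := fun x => φ x - m * ψ x)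
      (h1.sub (contDiff_const.mul hψs))
      ((h2.isCompact.union hψc.isCompact).of_isClosed_subset (isClosed_tsupport _) hsub)
      (hsub.trans (union_subset h3 hψt))
      (by rw [integral_sub hφi (hψi.const_mul m), integral_const_mul, hψ1]; simp [hm])
    have hw := h η e1 e2 e3
    rw [e4] at hw
    simp only [Pi.zero_apply, zero_mul, integral_zero, neg_zero] at hw
    have h5 : ∫ x in I l, u x * (φ x - m * ψ x) = (∫ x in I l, u x * φ x) - m * c := by
      rw [hcdef, ← integral_const_mul, ← integral_sub (hint φ h1.continuous h2)
        ((hint ψ hψs.continuous hψc).const_mul m)]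
      congr 1; funext x; ring
    have h6 : ∫ x, φ x • (u x - c) = ∫ x in I l, φ x • (u x - c) := by
      symm
      refine setIntegral_eq_integral_of_forall_compl_eq_zero fun x hx => ?_
      rw [image_eq_zero_of_notMem_tsupport fun h' => hx (h3 h'), zero_smul]
    have h7 : ∫ x in I l, φ x • (u x - c) = (∫ x in I l, u x * φ x) - c * m := by
      rw [hm, ← integral_const_mul, ← integral_sub (hint φ h1.continuous h2) (hφi.const_mul c)]
      congr 1; funext x; simp only [smul_eq_mul]; ring
    rw [h6, h7]
    linarith

/-- A function with an integrable weak derivative has an absolutely continuous representative. -/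
lemma IsWeakDeriv.exists_isPrim (hl : 0 < l) (hu : IntegrableOn u (I l)) (hv : IntegrableOn v (I l))
    (h : IsWeakDeriv l u v) :
    ∃ U, IsPrim U ((I l).indicator v) ∧ u =ᵐ[volume.restrict (I l)] U := by
  have hp := isPrim_indicator hv 0
  set U₀ : ℝ → ℝ := fun x => 0 + ∫ t in (-l)..x, (I l).indicator v t with hU₀
  have hU₀i : IntegrableOn U₀ (I l) := (integrableOn_I hl).2 (hp.continuous.intervalIntegrable _ _)
  have hw : IsWeakDeriv l (fun x => u x - U₀ x) 0 := by
    intro φ h1 h2 h3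
    have hd : Continuous (deriv φ) := h1.continuous_deriv (by exact_mod_cast le_top)
    obtain ⟨C, hC⟩ := h2.deriv.exists_bound_of_continuous hd
    have e1 := h φ h1 h2 h3
    have e2 := ((isWeakDeriv_of_isPrim hl hp).congr (ae_eq_refl _) indicator_ae_eq) φ h1 h2 h3
    simp only [sub_mul, Pi.zero_apply, zero_mul, integral_zero, neg_zero]
    rw [integral_sub, e1, e2, sub_self]
    · exact hu.mul_bdd (c := C) hd.aestronglyMeasurable (ae_of_all _ hC)
    · exact hU₀i.mul_bdd (c := C) hd.aestronglyMeasurable (ae_of_all _ hC)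
  obtain ⟨c, hc⟩ := ae_const_of_isWeakDeriv_zero hl (hu.sub hU₀i) hw
  refine ⟨_, isPrim_indicator hv c, ?_⟩
  filter_upwards [hc] with x hx
  simp only [hU₀, Pi.sub_apply] at hx
  linarith

lemma IsWeakDeriv.ae_unique {v' : ℝ → ℝ} (hv : IntegrableOn v (I l))
    (hv' : IntegrableOn v' (I l)) (h : IsWeakDeriv l u v) (h' : IsWeakDeriv l u v') :
    v =ᵐ[volume.restrict (I l)] v' := by
  have key := (isOpen_Ioo : IsOpen (I l)).ae_eq_zero_of_integral_contDiff_smul_eq_zero (μ := volume)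
    (f := fun x => v x - v' x) (hv.sub hv').locallyIntegrableOn ?_
  · refine (ae_restrict_iff' (measurableSet_Ioo : MeasurableSet (I l))).2 ?_
    filter_upwards [key] with x hx hxI using sub_eq_zero.1 (hx hxI)
  · intro φ h1 h2 h3
    obtain ⟨C, hC⟩ := h2.exists_bound_of_continuous h1.continuous
    have e : (fun x => φ x • (v x - v' x)) = fun x => v x * φ x - v' x * φ x := by
      funext x; simp only [smul_eq_mul]; ring
    have h6 : ∫ x, φ x • (v x - v' x) = ∫ x in I l, φ x • (v x - v' x) := by
      symm
      refine setIntegral_eq_integral_of_forall_compl_eq_zero fun x hx => ?_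
      rw [image_eq_zero_of_notMem_tsupport fun h' => hx (h3 h'), zero_smul]
    rw [h6, e, integral_sub (hv.mul_bdd (c := C) h1.continuous.aestronglyMeasurable (ae_of_all _ hC))
      (hv'.mul_bdd (c := C) h1.continuous.aestronglyMeasurable (ae_of_all _ hC))]
    linarith [h φ h1 h2 h3, h' φ h1 h2 h3]

lemma weakDeriv_spec (hv : IntegrableOn v (I l)) (h : IsWeakDeriv l u v) :
    IntegrableOn (weakDeriv l u) (I l) ∧ IsWeakDeriv l u (weakDeriv l u) := by
  have hex : ∃ v : ℝ → ℝ, IntegrableOn v (I l) ∧ IsWeakDeriv l u v := ⟨v, hv, h⟩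
  rw [weakDeriv, dif_pos hex]
  exact hex.choose_spec

lemma weakDeriv_ae_eq (hv : IntegrableOn v (I l)) (h : IsWeakDeriv l u v) :
    weakDeriv l u =ᵐ[volume.restrict (I l)] v :=
  (weakDeriv_spec hv h).2.ae_unique (weakDeriv_spec hv h).1 hv h

end


section
variable {l : ℝ} {u v : ℝ → ℝ}

/-! ### Traces and periodic representatives -/

lemma intervalIntegral_congr_of_ae_I {U : ℝ → ℝ} {a b : ℝ} (hab : a ≤ b) (ha : -l ≤ a) (hb : b ≤ l)
    (h : u =ᵐ[volume.restrict (I l)] U) : ∫ s in a..b, u s = ∫ s in a..b, U s := by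
  rw [intervalIntegral.integral_of_le hab, intervalIntegral.integral_of_le hab,
    integral_Ioc_eq_integral_Ioo, integral_Ioc_eq_integral_Ioo]
  exact integral_congr_ae (ae_restrict_of_ae_restrict_of_subset (Ioo_subset_Ioo ha hb) h)

lemma traceLeft_eq {U : ℝ → ℝ} (hl : 0 < l) (hU : Continuous U)
    (h : u =ᵐ[volume.restrict (I l)] U) : traceLeft l u = U (-l) := by
  refine Tendsto.limUnder_eq ?_
  have hd : HasDerivAt (fun x => ∫ s in (-l)..x, U s) (U (-l)) (-l) :=
    (hU.integral_hasStrictDerivAt (-l) (-l)).hasDerivAt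
  have ht := (hasDerivAt_iff_tendsto_slope_zero.1 hd).mono_left
    (nhdsWithin_mono _ (fun x (hx : 0 < x) => hx.ne') : 𝓝[>] (0 : ℝ) ≤ 𝓝[≠] 0)
  refine ht.congr' ?_
  filter_upwards [Ioo_mem_nhdsGT (show (0 : ℝ) < 2 * l by linarith)] with ρ hρ
  rw [intervalIntegral_congr_of_ae_I (by linarith [hρ.1]) le_rfl (by linarith [hρ.2]) h]
  simp

lemma traceRight_eq {U : ℝ → ℝ} (hl : 0 < l) (hU : Continuous U)
    (h : u =ᵐ[volume.restrict (I l)] U) : traceRight l u = U l := by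
  refine Tendsto.limUnder_eq ?_
  have hd : HasDerivAt (fun x => ∫ s in l..x, U s) (U l) l :=
    (hU.integral_hasStrictDerivAt l l).hasDerivAt
  have hd' : HasDerivAt (fun ρ => ∫ s in l..(l - ρ), U s) (-U l) 0 := by
    have h1 : HasDerivAt (fun ρ : ℝ => l - ρ) (-1) 0 := by
      simpa using (hasDerivAt_id (0 : ℝ)).const_sub l
    have h2 : HasDerivAt (fun x => ∫ s in l..x, U s) (U l) (l - 0) := by rwa [sub_zero]
    have h3 := h2.comp 0 h1
    rw [mul_neg_one] at h3
    exact h3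
  have ht := (hasDerivAt_iff_tendsto_slope_zero.1 hd'.neg).mono_left
    (nhdsWithin_mono _ (fun x (hx : 0 < x) => hx.ne') : 𝓝[>] (0 : ℝ) ≤ 𝓝[≠] 0)
  rw [neg_neg] at ht
  refine ht.congr' ?_
  filter_upwards [Ioo_mem_nhdsGT (show (0 : ℝ) < 2 * l by linarith)] with ρ hρ
  rw [intervalIntegral_congr_of_ae_I (by linarith [hρ.1]) (by linarith [hρ.2]) le_rfl h,
    intervalIntegral.integral_symm]
  simp

lemma perExt_periodic (hl : 0 < l) : Function.Periodic (perExt l u) (2 * l) := by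
  intro x
  have h : (x + 2 * l + l) / (2 * l) = (x + l) / (2 * l) + 1 := by field_simp; ring
  rw [perExt, perExt, h, Int.floor_add_one]
  congr 1
  push_cast; ring

lemma perExt_of_mem (hl : 0 < l) {x : ℝ} (hx : x ∈ Ico (-l) l) : perExt l u x = u x := by
  have h : ⌊(x + l) / (2 * l)⌋ = 0 := by
    rw [Int.floor_eq_zero_iff]
    exact ⟨div_nonneg (by linarith [hx.1]) (by linarith), (div_lt_one (by linarith)).2 (by linarith [hx.2])⟩
  rw [perExt, h]; simp

lemma perExt_ae_eq {U : ℝ → ℝ} (hl : 0 < l) (hU : Function.Periodic U (2 * l))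
    (h : u =ᵐ[volume.restrict (I l)] U) : perExt l u =ᵐ[volume] U := by
  have h1 : ∀ᵐ x : ℝ, x ∈ Ico (-l) l → u x = U x := by
    have h2 : u =ᵐ[volume.restrict (Ico (-l) l)] U := by
      rwa [I, restrict_Ioo_eq_restrict_Ico] at h
    exact (ae_restrict_iff' measurableSet_Ico).1 h2
  have h3 : ∀ᵐ x : ℝ, ∀ k : ℤ, x - 2 * l * k ∈ Ico (-l) l → u (x - 2 * l * k) = U (x - 2 * l * k) := by
    rw [ae_all_iff]
    exact fun k => (measurePreserving_sub_right volume (2 * l * (k : ℝ))).quasiMeasurePreserving.ae h1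
  filter_upwards [h3] with x hx
  set k := ⌊(x + l) / (2 * l)⌋ with hk
  have h5 := Int.floor_le ((x + l) / (2 * l))
  have h6 := Int.lt_floor_add_one ((x + l) / (2 * l))
  rw [← hk] at h5 h6
  rw [le_div_iff₀ (by linarith)] at h5
  rw [div_lt_iff₀ (by linarith)] at h6
  have h7 := hx k ⟨by nlinarith, by nlinarith⟩
  rw [perExt, ← hk, h7, mul_comm]
  exact hU.sub_int_mul_eq k

lemma MemL.integrableOn {p : ℝ≥0∞} (hp : 1 ≤ p) (h : MemL l p u) : IntegrableOn u (I l) := by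
  have : IsFiniteMeasure (volume.restrict (I l)) := ⟨by simp [I]⟩
  exact MemLp.integrable hp h

lemma MemL.congr_ae {p : ℝ≥0∞} (h : MemL l p u) (huv : u =ᵐ[volume.restrict (I l)] v) : MemL l p v :=
  (memLp_congr_ae huv).1 h

lemma memL_of_continuous {p : ℝ≥0∞} (hu : Continuous u) : MemL l p u := by
  have : IsFiniteMeasure (volume.restrict (I l)) := ⟨by simp [I]⟩
  obtain ⟨C, hC⟩ := (isCompact_Icc (a := -l) (b := l)).exists_bound_of_continuousOn hu.continuousOn
  refine MemLp.of_bound hu.aestronglyMeasurable C ?_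
  filter_upwards [ae_restrict_mem (measurableSet_Ioo : MeasurableSet (I l))] with x hx
  exact hC x (Ioo_subset_Icc_self hx)

lemma MemW12.weakDeriv_spec (h : MemW12 l u) : MemL l 2 (weakDeriv l u) ∧ IsWeakDeriv l u (weakDeriv l u) := by
  obtain ⟨-, v, hv, hw⟩ := h
  exact ⟨hv.congr_ae (weakDeriv_ae_eq (hv.integrableOn one_le_two) hw).symm,
    (ChenLubensky.weakDeriv_spec (hv.integrableOn one_le_two) hw).2⟩

/-- A `W^{1,2}` function with equal traces has a periodic absolutely continuous representative. -/
lemma MemW12.exists_periodic (hl : 0 < l) (hu : MemW12 l u) (ht : traceLeft l u = traceRight l u) :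
    ∃ U V : ℝ → ℝ, IsPrim U V ∧ Function.Periodic U (2 * l) ∧ Function.Periodic V (2 * l) ∧
      u =ᵐ[volume.restrict (I l)] U ∧ weakDeriv l u =ᵐ[volume.restrict (I l)] V ∧ MemL l 2 V := by
  obtain ⟨hv, hw⟩ := hu.weakDeriv_spec
  set v := weakDeriv l u with hvdef
  have hvi := hv.integrableOn one_le_two
  obtain ⟨U, hU, huU⟩ := hw.exists_isPrim hl (hu.1.integrableOn one_le_two) hvi
  rw [traceLeft_eq hl hU.continuous huU, traceRight_eq hl hU.continuous huU] at ht
  have hVI : ∀ x ∈ Ico (-l) l, perExt l v x = v x := fun x hx => perExt_of_mem hl hx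
  have hVp : Function.Periodic (perExt l v) (2 * l) := perExt_periodic hl
  have hVae : v =ᵐ[volume.restrict (I l)] perExt l v := by
    filter_upwards [ae_restrict_mem (measurableSet_Ioo : MeasurableSet (I l))] with x hx
    exact (hVI x (Ioo_subset_Ico_self hx)).symm
  have hVi : ∀ a b, IntervalIntegrable (perExt l v) volume a b := by
    refine hVp.intervalIntegrable (t := -l) (by linarith) ?_
    rw [show -l + 2 * l = l by ring, ← integrableOn_I hl]
    exact hvi.congr hVae
  have hint : ∀ x ∈ Icc (-l) l, ∫ t in (-l)..x, perExt l v t = U x - U (-l) := by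
    intro x hx
    rw [hU.sub_eq]
    exact intervalIntegral_congr_of_ae_I hx.1 le_rfl hx.2 (hVae.symm.trans indicator_ae_eq.symm)
  have hP : IsPrim (fun x => U (-l) + ∫ t in (-l)..x, perExt l v t) (perExt l v) := by
    refine ⟨locallyIntegrable_of_intervalIntegrable hVi, fun x y => ?_⟩
    rw [add_sub_add_left_eq_sub, intervalIntegral.integral_interval_sub_left (hVi _ _) (hVi _ _)]
  refine ⟨_, _, hP, fun x => ?_, hVp, ?_, hVae, hv.congr_ae hVae⟩
  · have h1 := hP.sub_eq x (x + 2 * l)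
    rw [hVp.intervalIntegral_add_eq x (-l), show -l + 2 * l = l by ring,
      hint l ⟨by linarith, le_rfl⟩, ← ht, sub_self] at h1
    exact sub_eq_zero.1 h1
  · filter_upwards [huU, ae_restrict_mem (measurableSet_Ioo : MeasurableSet (I l))] with x hx hxI
    rw [hx, hint x (Ioo_subset_Icc_self hxI)]
    ring

lemma IsPrim.weakDeriv_ae_eq {U V : ℝ → ℝ} (hl : 0 < l) (h : IsPrim U V) :
    weakDeriv l U =ᵐ[volume.restrict (I l)] V :=
  ChenLubensky.weakDeriv_ae_eq ((integrableOn_I hl).2 (h.intInt _ _)) (isWeakDeriv_of_isPrim hl h)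

lemma IsPrim.memW12 {U V : ℝ → ℝ} (hl : 0 < l) (h : IsPrim U V) (hV : MemL l 2 V) : MemW12 l U :=
  ⟨memL_of_continuous h.continuous, V, hV, isWeakDeriv_of_isPrim hl h⟩

lemma IsWeakDeriv.weakDeriv_congr {u' : ℝ → ℝ} (hv : IntegrableOn v (I l)) (h : IsWeakDeriv l u v)
    (hu : u =ᵐ[volume.restrict (I l)] u') :
    weakDeriv l u =ᵐ[volume.restrict (I l)] weakDeriv l u' :=
  (weakDeriv_ae_eq hv h).trans (weakDeriv_ae_eq hv (h.congr hu (ae_eq_refl _))).symm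

lemma MemW12.congr {u' : ℝ → ℝ} (h : MemW12 l u) (hu : u =ᵐ[volume.restrict (I l)] u') : MemW12 l u' :=
  ⟨h.1.congr_ae hu, h.2.imp fun _ hv => ⟨hv.1, hv.2.congr hu (ae_eq_refl _)⟩⟩

end

/-! ### The energy in terms of absolutely continuous representatives -/

/-- The integrand of the energy. -/
noncomputable def density (D₁ D₂ σ ε : ℝ) (t t' p' p'' : ℝ) : ℝ :=
  D₁ * ε * (p'' + Real.cos t * t') ^ 2 + D₂ / (2 * ε) * (p' + Real.sin t) ^ 4
      + 1 / ε * (p' + Real.sin t) ^ 2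
      + 4 * D₂ / ε * (p' + Real.sin t) ^ 2 * Real.sin (t / 2) ^ 4
      + ε * t' ^ 2 + 1 / ε * W D₂ σ t

/-- Absolutely continuous representatives of an admissible pair. -/
structure IsRep (l : ℝ) (T T' P P' P'' : ℝ → ℝ) : Prop where
  primT : IsPrim T T'
  primP : IsPrim P P'
  primP' : IsPrim P' P''
  perT : Function.Periodic T (2 * l)
  perT' : Function.Periodic T' (2 * l)
  perP : Function.Periodic P (2 * l)
  perP' : Function.Periodic P' (2 * l)
  memT' : MemL l 2 T'
  memP'' : MemL l 2 P''
  bound : ∀ x, |T x| ≤ Real.pi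

lemma le_of_ae_le_of_periodic {l C : ℝ} (hl : 0 < l) {U : ℝ → ℝ} (hU : Continuous U)
    (hp : Function.Periodic U (2 * l)) (h : ∀ᵐ x ∂volume.restrict (I l), U x ≤ C) (x : ℝ) :
    U x ≤ C := by
  have h1 : ∀ x ∈ Icc (-l) l, U x ≤ C := by
    by_contra! hcon
    obtain ⟨x, hx, hxC⟩ := hcon
    have hx' : x ∈ closure (I l) := by rwa [I, closure_Ioo (by linarith)]
    obtain ⟨y, hy, hyI⟩ := mem_closure_iff.1 hx' {y | C < U y} (isOpen_lt continuous_const hU) hxC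
    have hopen : IsOpen ({y | C < U y} ∩ I l) := (isOpen_lt continuous_const hU).inter isOpen_Ioo
    have hpos := hopen.measure_pos volume ⟨y, hy, hyI⟩
    have h0 := (ae_restrict_iff' (measurableSet_Ioo : MeasurableSet (I l))).1 h
    rw [ae_iff] at h0
    refine hpos.ne' (measure_mono_null (fun z hz => ?_) h0)
    simp only [mem_ofPred_eq, Classical.not_imp, not_le]
    exact ⟨hz.2, hz.1⟩
  obtain ⟨y, hy, hxy⟩ := hp.exists_mem_Ico (by linarith) x (-l)
  rw [hxy]
  exact h1 y ⟨hy.1, by linarith [hy.2]⟩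

lemma MemY.exists_isRep {l : ℝ} (hl : 0 < l) {θ g : ℝ → ℝ} (h : MemY l θ g) :
    ∃ T T' P P' P'', IsRep l T T' P P' P'' ∧ θ =ᵐ[volume.restrict (I l)] T ∧
      g =ᵐ[volume.restrict (I l)] P ∧ ∀ D₁ D₂ σ ε, F D₁ D₂ σ l ε θ g =
        ∫ x in I l, density D₁ D₂ σ ε (T x) (T' x) (P' x) (P'' x) := by
  obtain ⟨hθ, ⟨hg, hg'⟩, hb, tθ, tg, tg'⟩ := h
  obtain ⟨T, T', h1, h2, h3, h4, h5, h6⟩ := hθ.exists_periodic hl tθ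
  obtain ⟨P, Q, p1, p2, p3, p4, p5, p6⟩ := hg.exists_periodic hl tg
  obtain ⟨P', P'', q1, q2, q3, q4, q5, q6⟩ := hg'.exists_periodic hl tg'
  have hQ : Q =ᵐ[volume] P' :=
    (perExt_ae_eq hl p3 p5).symm.trans (perExt_ae_eq hl q2 q4)
  have hb1 : ∀ x, T x ≤ Real.pi := le_of_ae_le_of_periodic hl h1.continuous h2 (by
    filter_upwards [hb, h4] with x hx hx' using hx' ▸ (abs_le.1 hx).2)
  have hb2 : ∀ x, -T x ≤ Real.pi := le_of_ae_le_of_periodic hl h1.continuous.neg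
    (fun x => by simp [h2 x]) (by
    filter_upwards [hb, h4] with x hx hx'
    rw [← hx']; linarith [(abs_le.1 hx).1])
  refine ⟨T, T', P, P', P'', ⟨h1, p1.congr_ae hQ, q1, h2, h3, p2, q2, h6, q6,
    fun x => abs_le.2 ⟨by linarith [hb2 x], hb1 x⟩⟩, h4, p4, fun D₁ D₂ σ ε => ?_⟩
  refine integral_congr_ae ?_
  filter_upwards [h4, h5, q4, q5] with x e1 e2 e3 e4
  rw [e1, e2, e3, e4, density]

lemma memY_of_isPrim {l : ℝ} (hl : 0 < l) {T T' P P' P'' : ℝ → ℝ} (hT : IsPrim T T')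
    (hP : IsPrim P P') (hP' : IsPrim P' P'') (hT2 : MemL l 2 T') (hP2 : MemL l 2 P'')
    (hb : ∀ x, |T x| ≤ Real.pi) (eT : T (-l) = T l) (eP : P (-l) = P l) (eP' : P' (-l) = P' l) :
    MemY l T P ∧ ∀ D₁ D₂ σ ε, F D₁ D₂ σ l ε T P =
        ∫ x in I l, density D₁ D₂ σ ε (T x) (T' x) (P' x) (P'' x) := by
  have e1 := hT.weakDeriv_ae_eq hl
  have e2 := hP.weakDeriv_ae_eq hl
  have e4 : weakDeriv l (weakDeriv l P) =ᵐ[volume.restrict (I l)] P'' :=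
    ((isWeakDeriv_of_isPrim hl hP').weakDeriv_congr ((integrableOn_I hl).2 (hP'.intInt _ _))
      e2.symm).symm.trans (hP'.weakDeriv_ae_eq hl)
  refine ⟨⟨hT.memW12 hl hT2, ⟨hP.memW12 hl (memL_of_continuous hP'.continuous),
    (hP'.memW12 hl hP2).congr e2.symm⟩, ae_of_all _ hb, ?_, ?_, ?_⟩, fun D₁ D₂ σ ε => ?_⟩
  · rwa [traceLeft_eq hl hT.continuous (ae_eq_refl _), traceRight_eq hl hT.continuous (ae_eq_refl _)]
  · rwa [traceLeft_eq hl hP.continuous (ae_eq_refl _), traceRight_eq hl hP.continuous (ae_eq_refl _)]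
  · rwa [traceLeft_eq hl hP'.continuous e2, traceRight_eq hl hP'.continuous e2]
  · refine integral_congr_ae ?_
    filter_upwards [e1, e2, e4] with x e1 e2 e4
    rw [e1, e2, e4, density]


/-! ### The potential -/

section
variable {D₂ σ : ℝ}

lemma exists_critical (hD₂ : 0 ≤ D₂) (hσ : 0 < σ) :
    ∃ s ∈ Ioo (0 : ℝ) 1, 32 * D₂ * s ^ 3 + 8 * (1 + σ) * s - 4 * σ = 0 := by
  have hc : ContinuousOn (fun s : ℝ => 32 * D₂ * s ^ 3 + 8 * (1 + σ) * s - 4 * σ) (Icc 0 1) := by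
    fun_prop
  have := intermediate_value_Ioo (zero_le_one) hc
  obtain ⟨s, hs, h⟩ := this (show (0 : ℝ) ∈ _ by constructor <;> norm_num <;> linarith)
  exact ⟨s, hs, h⟩

/-- The value of `sin² (t / 2)` at the zeros of the potential. -/
lemma exists_well (hD₂ : 0 ≤ D₂) (hσ : 0 < σ) :
    ∃ s ∈ Ioo (0 : ℝ) 1, (∀ t, 4 * (Real.sin (t / 2) ^ 2 - s) ^ 2 ≤ W D₂ σ t) ∧
      ∀ t, W D₂ σ t = 0 ↔ Real.sin (t / 2) ^ 2 = s := by
  obtain ⟨s, hs, hcrit⟩ := exists_critical hD₂ hσ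
  set m := 8 * D₂ * s ^ 4 + 4 * (1 + σ) * s ^ 2 - 4 * σ * s with hm
  have hpoly : ∀ y : ℝ, 0 ≤ y → 4 * (y - s) ^ 2 ≤
      8 * D₂ * y ^ 4 + 4 * (1 + σ) * y ^ 2 - 4 * σ * y - m := by
    intro y hy
    have h1 : 8 * D₂ * y ^ 4 + 4 * (1 + σ) * y ^ 2 - 4 * σ * y - m =
        8 * D₂ * ((y - s) ^ 2 * (y ^ 2 + 2 * y * s + 3 * s ^ 2)) + 4 * (1 + σ) * (y - s) ^ 2 := by
      rw [hm]; linear_combination (y - s) * hcrit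
    rw [h1]
    have h2 : 0 ≤ 8 * D₂ * ((y - s) ^ 2 * (y ^ 2 + 2 * y * s + 3 * s ^ 2)) := by
      have := hs.1; positivity
    nlinarith [mul_nonneg hσ.le (sq_nonneg (y - s))]
  have hW0 : ∀ t, W₀ D₂ σ t - m = 8 * D₂ * (Real.sin (t / 2) ^ 2) ^ 4 +
      4 * (1 + σ) * (Real.sin (t / 2) ^ 2) ^ 2 - 4 * σ * (Real.sin (t / 2) ^ 2) - m := fun t => by
    rw [W₀]; ring
  have hat : ∀ t, Real.sin (t / 2) ^ 2 = s → W₀ D₂ σ t = m := fun t ht => by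
    have := hW0 t
    rw [ht] at this; rw [hm] at *; linarith
  have hle : ∀ t, 4 * (Real.sin (t / 2) ^ 2 - s) ^ 2 ≤ W₀ D₂ σ t - m := fun t => by
    rw [hW0]; exact hpoly _ (sq_nonneg _)
  have hst : Real.sin (2 * Real.arcsin (√s) / 2) ^ 2 = s := by
    rw [mul_div_cancel_left₀ _ two_ne_zero, Real.sin_arcsin (by linarith [Real.sqrt_nonneg s])
      (Real.sqrt_le_one.2 hs.2.le), Real.sq_sqrt hs.1.le]
  have hinf : ⨅ t : ℝ, W₀ D₂ σ t = m := by
    have : IsLeast (range (W₀ D₂ σ)) m := by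
      refine ⟨⟨_, hat _ hst⟩, ?_⟩
      rintro _ ⟨t, rfl⟩
      nlinarith [hle t, sq_nonneg (Real.sin (t / 2) ^ 2 - s)]
    exact this.isGLB.csInf_eq (range_nonempty _)
  have hWeq : ∀ t, W D₂ σ t = W₀ D₂ σ t - m := fun t => by rw [W, a₀, hinf]; ring
  refine ⟨s, hs, fun t => by rw [hWeq]; exact hle t, fun t => ⟨fun h => ?_, fun h => ?_⟩⟩
  · have := hle t
    rw [← hWeq, h] at this
    have h2 : (Real.sin (t / 2) ^ 2 - s) ^ 2 = 0 := le_antisymm (by linarith) (sq_nonneg _)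
    linarith [pow_eq_zero_iff (two_ne_zero) |>.1 h2]
  · rw [hWeq, hat t h, sub_self]

lemma W_nonneg (hD₂ : 0 ≤ D₂) (hσ : 0 < σ) (t : ℝ) : 0 ≤ W D₂ σ t := by
  obtain ⟨s, -, h, -⟩ := exists_well hD₂ hσ
  exact le_trans (by positivity) (h t)

lemma sin_sq_abs_half (t : ℝ) : Real.sin (|t| / 2) ^ 2 = Real.sin (t / 2) ^ 2 := by
  rcases abs_cases t with ⟨h, -⟩ | ⟨h, -⟩ <;> rw [h]
  rw [neg_div, Real.sin_neg, neg_sq]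

lemma β_spec (hD₂ : 0 ≤ D₂) (hσ : 0 < σ) : 0 < β D₂ σ ∧ β D₂ σ < Real.pi ∧
    ∀ t ∈ Icc (-Real.pi) Real.pi, W D₂ σ t = 0 ↔ t = β D₂ σ ∨ t = -β D₂ σ := by
  obtain ⟨s, hs, -, hz⟩ := exists_well hD₂ hσ
  have hq0 : 0 < √s := Real.sqrt_pos.2 hs.1
  have hq1 : √s < 1 := by rw [Real.sqrt_lt' one_pos]; linarith [hs.2]
  set b := 2 * Real.arcsin (√s) with hb
  have hb0 : 0 < b := by have := Real.arcsin_pos.2 hq0; linarith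
  have hbπ : b < Real.pi := by have := Real.arcsin_lt_pi_div_two.2 hq1; linarith
  have hsb : Real.sin (b / 2) = √s := by
    rw [hb, mul_div_cancel_left₀ _ two_ne_zero, Real.sin_arcsin (by linarith) hq1.le]
  have huniq : ∀ t, 0 ≤ t → t ≤ Real.pi → Real.sin (t / 2) ^ 2 = s → t = b := by
    intro t h0 h1 h
    have h2 : 0 ≤ Real.sin (t / 2) := Real.sin_nonneg_of_nonneg_of_le_pi (by linarith) (by linarith [Real.pi_pos])
    have h3 : Real.sin (t / 2) = Real.sin (b / 2) := by
      rw [hsb, ← h, Real.sqrt_sq h2]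
    have := Real.injOn_sin ⟨by linarith [Real.pi_pos], by linarith⟩ ⟨by linarith, by linarith⟩ h3
    linarith
  have hbz : Real.sin (b / 2) ^ 2 = s := by rw [hsb, Real.sq_sqrt hs.1.le]
  have hβ : β D₂ σ = b := by
    have : IsLeast {t : ℝ | 0 < t ∧ W D₂ σ t = 0} b := by
      refine ⟨⟨hb0, (hz b).2 hbz⟩, fun t ht => ?_⟩
      by_contra hlt
      have := huniq t ht.1.le (by linarith) ((hz t).1 ht.2)
      linarith
    exact this.csInf_eq
  rw [hβ]
  refine ⟨hb0, hbπ, fun t ht => ?_⟩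
  rw [hz, ← sin_sq_abs_half]
  constructor
  · intro h
    have := huniq |t| (abs_nonneg t) (abs_le.2 ht) h
    exact eq_or_eq_neg_of_abs_eq this
  · intro h
    have : |t| = b := by rcases h with rfl | rfl <;> simp [abs_of_pos hb0]
    rw [this, hbz]

lemma continuous_W : Continuous (W D₂ σ) := by
  unfold W W₀
  fun_prop

lemma continuous_sqrt_W : Continuous fun t => √(W D₂ σ t) := continuous_W.sqrt

lemma W_neg (t : ℝ) : W D₂ σ (-t) = W D₂ σ t := by
  unfold W W₀
  rw [neg_div, Real.sin_neg, (by decide : Even 8).neg_pow, (by decide : Even 4).neg_pow,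
    (by decide : Even 2).neg_pow]

lemma exists_W_le (D₂ σ : ℝ) : ∃ C, 0 < C ∧ ∀ t, W D₂ σ t ≤ C := by
  obtain ⟨C, hC⟩ := (isCompact_Icc (a := 0) (b := 2 * Real.pi)).exists_bound_of_continuousOn
    (continuous_W (D₂ := D₂) (σ := σ)).continuousOn
  have hp : Function.Periodic (W D₂ σ) (2 * Real.pi) := fun t => by
    unfold W W₀
    have : (t + 2 * Real.pi) / 2 = t / 2 + Real.pi := by ring
    rw [this, Real.sin_add_pi, (by decide : Even 8).neg_pow, (by decide : Even 4).neg_pow,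
    (by decide : Even 2).neg_pow]
  refine ⟨|C| + 1, by positivity, fun t => ?_⟩
  obtain ⟨y, hy, hty⟩ := hp.exists_mem_Ico₀ (by positivity) t
  rw [hty]
  have := (abs_le.1 (hC y (Ico_subset_Icc_self hy))).2
  linarith [le_abs_self C]

lemma hasDerivAt_Φ (t : ℝ) : HasDerivAt (Φ D₂ σ) (2 * √(W D₂ σ t)) t :=
  (continuous_sqrt_W.integral_hasStrictDerivAt _ t).hasDerivAt.const_mul 2

lemma Φ_neg_β : Φ D₂ σ (-β D₂ σ) = 0 := by simp [Φ]

lemma Φ_mono : Monotone (Φ D₂ σ) :=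
  monotone_of_deriv_nonneg (fun t => (hasDerivAt_Φ t).differentiableAt) fun t => by
    rw [(hasDerivAt_Φ t).deriv]; positivity

lemma continuous_Φ : Continuous (Φ D₂ σ) :=
  continuous_iff_continuousAt.2 fun t => (hasDerivAt_Φ t).continuousAt

lemma Φ_β_pos (hD₂ : 0 ≤ D₂) (hσ : 0 < σ) : 0 < Φ D₂ σ (β D₂ σ) := by
  obtain ⟨h0, hπ, hz⟩ := β_spec hD₂ hσ
  refine mul_pos two_pos (intervalIntegral.intervalIntegral_pos_of_pos_on
    (continuous_sqrt_W.intervalIntegrable _ _) (fun t ht => ?_) (by linarith))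
  refine Real.sqrt_pos.2 (lt_of_le_of_ne (W_nonneg hD₂ hσ t) fun h => ?_)
  rcases (hz t ⟨by linarith [ht.1], by linarith [ht.2]⟩).1 h.symm with h | h
  · linarith [ht.2]
  · linarith [ht.1]

end


/-! ### Competitors with small energy -/

section
variable {D₂ σ : ℝ}

/-- A transition profile for the regularized potential `W + λ`. -/
lemma exists_profile (hD₂ : 0 ≤ D₂) (hσ : 0 < σ) {lam : ℝ} (hlam : 0 < lam) :
    ∃ (q : ℝ → ℝ) (L : ℝ), 0 < L ∧ (∀ s, HasDerivAt q (√(W D₂ σ (q s) + lam)) s) ∧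
      (∀ s, q (-s) = -q s) ∧ q L = β D₂ σ := by
  have hpos : ∀ t, 0 < W D₂ σ t + lam := fun t => by linarith [W_nonneg hD₂ hσ t]
  set k : ℝ → ℝ := fun t => (√(W D₂ σ t + lam))⁻¹ with hk
  have hkpos : ∀ t, 0 < k t := fun t => inv_pos.2 (Real.sqrt_pos.2 (hpos t))
  have hkc : Continuous k :=
    (continuous_W.add continuous_const).sqrt.inv₀ fun t => (Real.sqrt_pos.2 (hpos t)).ne'
  set ψ : ℝ → ℝ := fun s => ∫ t in (0 : ℝ)..s, k t with hψ
  have hψd : ∀ s, HasDerivAt ψ (k s) s := fun s => (hkc.integral_hasStrictDerivAt 0 s).hasDerivAt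
  have hψc : Continuous ψ := continuous_iff_continuousAt.2 fun s => (hψd s).continuousAt
  have hψm : StrictMono ψ := strictMono_of_deriv_pos fun s => by rw [(hψd s).deriv]; exact hkpos s
  have hψodd : ∀ s, ψ (-s) = -ψ s := fun s => by
    have h1 := intervalIntegral.integral_comp_neg (a := 0) (b := s) k
    have h2 : ∀ t, k (-t) = k t := fun t => by rw [hk]; simp only [W_neg]
    simp only [h2, neg_zero] at h1
    rw [hψ]; simp only
    rw [h1, intervalIntegral.integral_symm]
  obtain ⟨C, hC0, hC⟩ := exists_W_le D₂ σ
  set c := (√(C + lam))⁻¹ with hc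
  have hc0 : 0 < c := inv_pos.2 (Real.sqrt_pos.2 (by linarith))
  have hck : ∀ t, c ≤ k t := fun t =>
    inv_anti₀ (Real.sqrt_pos.2 (hpos t)) (Real.sqrt_le_sqrt (by linarith [hC t]))
  have hlow : ∀ s, 0 ≤ s → c * s ≤ ψ s := fun s hs => by
    have := intervalIntegral.integral_mono_on (μ := volume) hs (intervalIntegrable_const (c := c))
      (hkc.intervalIntegrable 0 s) fun t _ => hck t
    simpa [mul_comm] using this
  have htop : Tendsto ψ atTop atTop := by
    refine tendsto_atTop_mono' _ ?_ (tendsto_id.const_mul_atTop hc0)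
    filter_upwards [eventually_ge_atTop 0] with s hs using hlow s hs
  have hbot : Tendsto ψ atBot atBot := by
    have h1 : Tendsto (fun s => -ψ (-s)) atBot atBot :=
      tendsto_neg_atTop_atBot.comp (htop.comp tendsto_neg_atBot_atTop)
    refine h1.congr fun s => ?_
    rw [hψodd, neg_neg]
  let e := hψm.orderIsoOfSurjective ψ (hψc.surjective htop hbot)
  have he : ∀ s, ψ (e.symm s) = s := fun s => e.apply_symm_apply s
  have he' : ∀ s, e.symm (ψ s) = s := fun s => e.symm_apply_apply s
  refine ⟨e.symm, ψ (β D₂ σ), ?_, fun s => ?_, fun s => ?_, he' _⟩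
  · have h0 : ψ 0 = 0 := by simp [hψ]
    rw [← h0]; exact hψm (β_spec hD₂ hσ).1
  · have := HasDerivAt.of_local_left_inverse (f := ψ) (g := e.symm) (a := s)
      e.symm.continuous.continuousAt (hψd _) (hkpos _).ne' (Eventually.of_forall he)
    simpa [hk] using this
  · apply hψm.injective
    rw [he, hψodd, he]

/-- The periodic competitor with two transition layers at `±l/2`. -/
lemma exists_layers (hD₂ : 0 ≤ D₂) (hσ : 0 < σ) {lam l : ℝ} (hlam : 0 < lam) (hl : 0 < l) :
    ∃ ε₀ > 0, ∀ ε, 0 < ε → ε < ε₀ → ∃ T T' : ℝ → ℝ, IsPrim T T' ∧ MemL l 2 T' ∧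
      (∀ x, |T x| ≤ Real.pi) ∧ (∀ x, T (-x) = T x) ∧ (∀ x ∈ Icc 0 l, T (l - x) = -T x) ∧
      ∫ x in I l, (ε * T' x ^ 2 + 1 / ε * W D₂ σ (T x)) ≤
        2 * (2 * ∫ t in (-β D₂ σ)..β D₂ σ, √(W D₂ σ t + lam)) := by
  obtain ⟨q, L, hL, hqd, hqodd, hqL⟩ := exists_profile hD₂ hσ hlam
  obtain ⟨hβ0, hβπ, hβz⟩ := β_spec hD₂ hσ
  obtain ⟨C, hC0, hC⟩ := exists_W_le D₂ σ
  have hqm : Monotone q := monotone_of_deriv_nonneg (fun s => (hqd s).differentiableAt) fun s => by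
    rw [(hqd s).deriv]; positivity
  have hqL' : q (-L) = -β D₂ σ := by rw [hqodd, hqL]
  have hWβ : W D₂ σ (β D₂ σ) = 0 := (hβz _ ⟨by linarith, hβπ.le⟩).2 (Or.inl rfl)
  have hWβ' : W D₂ σ (-β D₂ σ) = 0 := (hβz _ ⟨by linarith, by linarith⟩).2 (Or.inr rfl)
  have hqlip : LipschitzWith (√(C + lam)).toNNReal q := by
    refine lipschitzWith_of_nnnorm_deriv_le (fun s => (hqd s).differentiableAt) fun s => ?_
    rw [(hqd s).deriv, ← NNReal.coe_le_coe, coe_nnnorm, Real.norm_of_nonneg (Real.sqrt_nonneg _),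
      Real.coe_toNNReal _ (Real.sqrt_nonneg _)]
    exact Real.sqrt_le_sqrt (by linarith [hC (q s)])
  refine ⟨l / 2 / L, by positivity, fun ε hε hεlt => ?_⟩
  have hLε : L < l / 2 / ε := by
    rw [lt_div_iff₀ hε]; rw [lt_div_iff₀ hL] at hεlt; linarith
  set r : ℝ → ℝ := fun x => (l / 2 - |x|) / ε with hr
  set T : ℝ → ℝ := fun x => q (max (-L) (min L (r x))) with hT
  have hrlip : LipschitzWith (1 / ε).toNNReal r := by
    refine LipschitzWith.of_dist_le_mul fun x y => ?_
    rw [Real.coe_toNNReal _ (by positivity), Real.dist_eq, Real.dist_eq, hr]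
    simp only
    rw [← sub_div, abs_div, abs_of_pos hε, div_eq_mul_inv, mul_comm, one_div]
    refine mul_le_mul_of_nonneg_left ?_ (by positivity)
    rw [sub_sub_sub_cancel_left, abs_sub_comm x y]
    exact abs_abs_sub_abs_le_abs_sub y x
  have hTlip := hqlip.comp ((hrlip.const_min L).const_max (-L))
  change LipschitzWith _ T at hTlip
  have hTprim : IsPrim T (deriv T) := IsPrim.of_lipschitz hTlip (by
    filter_upwards [hTlip.ae_differentiableAt_real] with x hx using hx.hasDerivAt)
  have hTβ : ∀ x, |T x| ≤ β D₂ σ := fun x => by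
    rw [abs_le, ← hqL', ← hqL]
    exact ⟨hqm (le_max_left _ _), hqm (max_le (by linarith) (min_le_left _ _))⟩
  have hTeven : ∀ x, T (-x) = T x := fun x => by simp only [hT, hr, abs_neg]
  have hTodd : ∀ x ∈ Icc 0 l, T (l - x) = -T x := fun x hx => by
    have h1 : r (l - x) = -r x := by
      simp only [hr]; rw [abs_of_nonneg (sub_nonneg.2 hx.2), abs_of_nonneg hx.1]; ring
    simp only [hT]
    rw [h1, ← hqodd]
    congr 1
    rcases le_total L (r x) with h2 | h2 <;> rcases le_total (-L) (r x) with h3 | h3 <;>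
      simp only [max_def, min_def] <;> split_ifs <;> linarith
  have hT' : ∀ x, 0 < x → x ≠ l / 2 - ε * L → x ≠ l / 2 + ε * L →
      ε * deriv T x ^ 2 + 1 / ε * W D₂ σ (T x) ≤ -(2 * √(W D₂ σ (T x) + lam) * deriv T x) := by
    intro x hx h1 h2
    have hrx : r x = (l / 2 - x) / ε := by simp only [hr, abs_of_pos hx]
    have hrc : Continuous r := hrlip.continuous
    have hne1 : r x ≠ L := fun h => h1 (by
      rw [hrx, div_eq_iff hε.ne'] at h; linarith)
    have hne2 : r x ≠ -L := fun h => h2 (by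
      rw [hrx, div_eq_iff hε.ne'] at h; linarith)
    rcases lt_or_gt_of_ne hne1 with h3 | h3
    · rcases lt_or_gt_of_ne hne2 with h4 | h4
      · have hTx : T x = -β D₂ σ := by
          simp only [hT]; rw [min_eq_right h3.le, max_eq_left h4.le, hqL']
        have hev : T =ᶠ[𝓝 x] fun _ => -β D₂ σ := by
          filter_upwards [hrc.continuousAt.eventually_lt_const h4] with y hy
          simp only [hT]; rw [min_eq_right (by linarith), max_eq_left hy.le, hqL']
        rw [hev.deriv_eq, deriv_const, hTx, hWβ']; simp
      · have hTx : T x = q (r x) := by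
          simp only [hT]; rw [min_eq_right h3.le, max_eq_right h4.le]
        have hev : T =ᶠ[𝓝 x] fun y => q ((l / 2 - y) / ε) := by
          filter_upwards [hrc.continuousAt.eventually_lt_const h3,
            hrc.continuousAt.eventually_const_lt h4, eventually_gt_nhds hx] with y hy hy' hy0
          simp only [hT]
          rw [min_eq_right hy.le, max_eq_right hy'.le]
          simp only [hr, abs_of_pos hy0]
        have hd1 : HasDerivAt (fun y : ℝ => (l / 2 - y) / ε) (-1 / ε) x :=
          ((hasDerivAt_id x).const_sub (l / 2)).div_const ε
        have hd2 := hqd ((l / 2 - x) / ε)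
        have hd := hd2.comp x hd1
        have hd' : deriv T x = √(W D₂ σ (T x) + lam) * (-1 / ε) := by
          rw [hev.deriv_eq, hTx, hrx]; exact hd.deriv
        rw [hd']
        have hk2 : √(W D₂ σ (T x) + lam) ^ 2 = W D₂ σ (T x) + lam :=
          Real.sq_sqrt (by linarith [W_nonneg hD₂ hσ (T x)])
        have e1 : ε * (√(W D₂ σ (T x) + lam) * (-1 / ε)) ^ 2 = (W D₂ σ (T x) + lam) / ε := by
          rw [mul_pow, hk2]; field_simp
        have e2 : -(2 * √(W D₂ σ (T x) + lam) * (√(W D₂ σ (T x) + lam) * (-1 / ε))) =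
            2 * (W D₂ σ (T x) + lam) / ε := by
          rw [← hk2]; field_simp; rw [Real.sqrt_sq (Real.sqrt_nonneg _)]
        rw [e1, e2, one_div, inv_mul_eq_div, ← add_div]
        exact div_le_div_of_nonneg_right (by linarith) hε.le
    · have hTx : T x = β D₂ σ := by
        simp only [hT]; rw [min_eq_left h3.le, max_eq_right (by linarith), hqL]
      have hev : T =ᶠ[𝓝 x] fun _ => β D₂ σ := by
        filter_upwards [hrc.continuousAt.eventually_const_lt h3] with y hy
        simp only [hT]; rw [min_eq_left hy.le, max_eq_right (by linarith), hqL]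
      rw [hev.deriv_eq, deriv_const, hTx, hWβ]; simp
  have hT0 : T 0 = β D₂ σ := by
    have : r 0 = l / 2 / ε := by simp [hr]
    simp only [hT]; rw [this, min_eq_left hLε.le, max_eq_right (by linarith), hqL]
  have hTl : T l = -β D₂ σ := by
    have := hTodd 0 ⟨le_rfl, hl.le⟩
    rwa [sub_zero, hT0] at this
  have hmem : MemL l 2 (deriv T) := by
    have : IsFiniteMeasure (volume.restrict (I l)) := ⟨by simp [I]⟩
    exact MemLp.of_bound (measurable_deriv T).aestronglyMeasurable _
      (ae_of_all _ fun x => norm_deriv_le_of_lipschitz hTlip)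
  have hdens : IntervalIntegrable (fun x => ε * deriv T x ^ 2 + 1 / ε * W D₂ σ (T x)) volume (-l) l := by
    refine IntervalIntegrable.add ((integrableOn_I hl).1 ?_)
      ((continuous_const.mul (continuous_W.comp hTlip.continuous)).intervalIntegrable _ _)
    exact (MemLp.integrable_sq hmem).const_mul ε
  refine ⟨T, deriv T, hTprim, hmem, fun x => (hTβ x).trans hβπ.le, hTeven, hTodd, ?_⟩
  have hcomp := hTprim.comp (f := fun s => 2 * ∫ t in (-β D₂ σ)..s, √(W D₂ σ t + lam))
    (f' := fun t => 2 * √(W D₂ σ t + lam))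
    (fun t => (((continuous_W.add continuous_const).sqrt).integral_hasStrictDerivAt _ t).hasDerivAt.const_mul 2)
    (continuous_const.mul (continuous_W.add continuous_const).sqrt)
  have hhalf : ∫ x in (0 : ℝ)..l, (ε * deriv T x ^ 2 + 1 / ε * W D₂ σ (T x)) ≤
      2 * ∫ t in (-β D₂ σ)..β D₂ σ, √(W D₂ σ t + lam) := by
    have h1 := hcomp.sub_eq 0 l
    rw [hT0, hTl, intervalIntegral.integral_same, mul_zero, zero_sub] at h1
    rw [← neg_neg (2 * _), h1, ← intervalIntegral.integral_neg]
    refine intervalIntegral.integral_mono_ae_restrict hl.le ?_ (hcomp.intInt 0 l).neg ?_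
    · exact hdens.mono_set (by
        rw [uIcc_of_le hl.le, uIcc_of_le (by linarith)]; exact Icc_subset_Icc (by linarith) le_rfl)
    · refine (ae_restrict_iff' measurableSet_Icc).2 ?_
      filter_upwards [Measure.ae_ne volume 0, Measure.ae_ne volume (l / 2 - ε * L),
        Measure.ae_ne volume (l / 2 + ε * L)] with x h0 h1 h2 hx
      exact hT' x (lt_of_le_of_ne hx.1 h0.symm) h1 h2
  have heven : ∀ x, ε * deriv T (-x) ^ 2 + 1 / ε * W D₂ σ (T (-x)) =
      ε * deriv T x ^ 2 + 1 / ε * W D₂ σ (T x) := fun x => by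
    have h1 : deriv T x = -deriv T (-x) := by
      have := deriv_comp_neg T x
      rwa [show (fun x => T (-x)) = T from funext hTeven] at this
    rw [h1, hTeven, neg_sq]
  have hneg : ∫ x in (-l)..0, (ε * deriv T x ^ 2 + 1 / ε * W D₂ σ (T x)) =
      ∫ x in (0 : ℝ)..l, (ε * deriv T x ^ 2 + 1 / ε * W D₂ σ (T x)) := by
    have := intervalIntegral.integral_comp_neg (a := 0) (b := l)
      (fun x => ε * deriv T x ^ 2 + 1 / ε * W D₂ σ (T x))
    rw [neg_zero] at this
    rw [← this]
    exact intervalIntegral.integral_congr fun x _ => heven x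
  rw [setIntegral_I hl, ← intervalIntegral.integral_add_adjacent_intervals (b := 0), hneg]
  · linarith
  · exact hdens.mono_set (by
      rw [uIcc_of_le (by linarith), uIcc_of_le (by linarith)]; exact Icc_subset_Icc le_rfl hl.le)
  · exact hdens.mono_set (by
      rw [uIcc_of_le hl.le, uIcc_of_le (by linarith)]; exact Icc_subset_Icc (by linarith) le_rfl)

lemma integral_sqrt_add_le (hD₂ : 0 ≤ D₂) (hσ : 0 < σ) {lam : ℝ} (hlam : 0 < lam) :
    2 * ∫ t in (-β D₂ σ)..β D₂ σ, √(W D₂ σ t + lam) ≤ Φ D₂ σ (β D₂ σ) + 4 * β D₂ σ * √lam := by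
  have hβ := (β_spec hD₂ hσ).1
  have h1 : ∫ t in (-β D₂ σ)..β D₂ σ, √(W D₂ σ t + lam) ≤
      ∫ t in (-β D₂ σ)..β D₂ σ, (√(W D₂ σ t) + √lam) := by
    refine intervalIntegral.integral_mono_on (by linarith)
      ((continuous_W.add continuous_const).sqrt.intervalIntegrable _ _)
      ((continuous_sqrt_W.add continuous_const).intervalIntegrable _ _) fun t _ => ?_
    rw [Real.sqrt_le_left (by positivity)]
    nlinarith [Real.sq_sqrt (W_nonneg hD₂ hσ t), Real.sq_sqrt hlam.le,
      mul_nonneg (Real.sqrt_nonneg (W D₂ σ t)) (Real.sqrt_nonneg lam)]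
  rw [intervalIntegral.integral_add (continuous_sqrt_W.intervalIntegrable _ _)
    intervalIntegrable_const, intervalIntegral.integral_const, smul_eq_mul] at h1
  rw [Φ]
  linarith

/-- Upper bound: there are admissible pairs of energy at most `2 Φ(β) + δ`. -/
lemma exists_competitor (hD₂ : 0 ≤ D₂) (hσ : 0 < σ) {l δ : ℝ} (hl : 0 < l) (hδ : 0 < δ) (D₁ : ℝ) :
    ∃ ε₀ > 0, ∀ ε, 0 < ε → ε < ε₀ → ∃ T P : ℝ → ℝ, MemY l T P ∧
      F D₁ D₂ σ l ε T P ≤ 2 * Φ D₂ σ (β D₂ σ) + δ := by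
  have hβ := (β_spec hD₂ hσ).1
  set lam := (δ / (8 * β D₂ σ)) ^ 2 with hlamdef
  have hlam : 0 < lam := by positivity
  have hsq : √lam = δ / (8 * β D₂ σ) := Real.sqrt_sq (by positivity)
  have hle := integral_sqrt_add_le hD₂ hσ hlam
  rw [hsq, show 4 * β D₂ σ * (δ / (8 * β D₂ σ)) = δ / 2 by field_simp; ring] at hle
  obtain ⟨ε₀, h0, hε₀⟩ := exists_layers hD₂ hσ hlam hl
  refine ⟨ε₀, h0, fun ε hε hlt => ?_⟩
  obtain ⟨T, T', hT, hT2, hTπ, hev, hodd, hE⟩ := hε₀ ε hε hlt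
  have hsc : Continuous fun x => -Real.sin (T x) := (Real.continuous_sin.comp hT.continuous).neg
  have hP : IsPrim (fun x => ∫ t in (0 : ℝ)..x, -Real.sin (T t)) (fun x => -Real.sin (T x)) :=
    ⟨hsc.locallyIntegrable, fun x y => intervalIntegral.integral_interval_sub_left
      (hsc.intervalIntegrable _ _) (hsc.intervalIntegrable _ _)⟩
  have hP' : IsPrim (fun x => -Real.sin (T x)) (fun x => -Real.cos (T x) * T' x) :=
    hT.comp (fun t => (Real.hasDerivAt_sin t).neg) Real.continuous_cos.neg
  have hz : ∫ t in (0 : ℝ)..l, -Real.sin (T t) = 0 := by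
    have h1 := intervalIntegral.integral_comp_sub_left (a := 0) (b := l)
      (fun t => -Real.sin (T t)) l
    rw [sub_self, sub_zero] at h1
    have h2 : ∫ t in (0 : ℝ)..l, -Real.sin (T (l - t)) = ∫ t in (0 : ℝ)..l, -(-Real.sin (T t)) := by
      refine intervalIntegral.integral_congr fun t ht => ?_
      rw [uIcc_of_le hl.le] at ht
      simp only [hodd t ht, Real.sin_neg]
    rw [h2, intervalIntegral.integral_neg] at h1
    linarith
  have hz' : ∫ t in (0 : ℝ)..(-l), -Real.sin (T t) = 0 := by
    have h1 := intervalIntegral.integral_comp_neg (a := 0) (b := l) (fun t => -Real.sin (T t))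
    simp only [hev, neg_zero] at h1
    rw [intervalIntegral.integral_symm, ← h1, hz, neg_zero]
  obtain ⟨hY, hF⟩ := memY_of_isPrim hl hT hP hP' hT2 (by
      obtain ⟨m, hm⟩ := hT2
      refine MemLp.of_le ⟨m, hm⟩ (((Real.continuous_cos.comp hT.continuous).neg.aestronglyMeasurable).mul m)
        (ae_of_all _ fun x => ?_)
      rw [norm_mul, norm_neg, Real.norm_eq_abs (Real.cos _)]
      exact mul_le_of_le_one_left (norm_nonneg _) (Real.abs_cos_le_one _))
    hTπ (hev l) (by simp only [hz, hz']) (by simp only [hev])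
  refine ⟨_, _, hY, ?_⟩
  rw [hF]
  have hden : ∀ x, density D₁ D₂ σ ε (T x) (T' x) (-Real.sin (T x)) (-Real.cos (T x) * T' x) =
      ε * T' x ^ 2 + 1 / ε * W D₂ σ (T x) := fun x => by
    rw [density]; ring
  simp only [hden]
  linarith

end


/-! ### Consequences of an energy bound -/

section
variable {D₁ D₂ σ l ε : ℝ} {T T' P P' P'' : ℝ → ℝ}

lemma intervalIntegrable_sq (hl : 0 < l) {f : ℝ → ℝ} (hf : MemL l 2 f) :
    IntervalIntegrable (fun x => f x ^ 2) volume (-l) l :=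
  (integrableOn_I hl).1 (MemLp.integrable_sq hf)

lemma IsRep.intervalIntegrable_density (hl : 0 < l) (h : IsRep l T T' P P' P'') :
    IntervalIntegrable (fun x => density D₁ D₂ σ ε (T x) (T' x) (P' x) (P'' x)) volume (-l) l := by
  have hT := h.primT.continuous
  have hP := h.primP'.continuous
  have hs : Continuous fun x => P' x + Real.sin (T x) := hP.add (Real.continuous_sin.comp hT)
  have hm : MemL l 2 fun x => P'' x + Real.cos (T x) * T' x := by
    refine MemLp.add h.memP'' ?_
    refine MemLp.of_le h.memT'
      (((Real.continuous_cos.comp hT).aestronglyMeasurable).mul h.memT'.1) (ae_of_all _ fun x => ?_)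
    rw [norm_mul, Real.norm_eq_abs (Real.cos _)]
    exact mul_le_of_le_one_left (norm_nonneg _) (Real.abs_cos_le_one _)
  unfold density
  refine (((((intervalIntegrable_sq hl hm).const_mul _).add ?_).add ?_).add ?_).add
    ((intervalIntegrable_sq hl h.memT').const_mul _) |>.add ?_
  · exact (continuous_const.mul (hs.pow 4)).intervalIntegrable _ _
  · exact (continuous_const.mul (hs.pow 2)).intervalIntegrable _ _
  · exact ((continuous_const.mul (hs.pow 2)).mul
      ((Real.continuous_sin.comp (hT.div_const 2)).pow 4)).intervalIntegrable _ _
  · exact (continuous_const.mul (continuous_W.comp hT)).intervalIntegrable _ _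

lemma le_density (hD₁ : 0 ≤ D₁) (hD₂ : 0 ≤ D₂) (hε : 0 < ε) (t t' p' p'' : ℝ) :
    1 / ε * (p' + Real.sin t) ^ 2 + ε * t' ^ 2 + 1 / ε * W D₂ σ t ≤
      density D₁ D₂ σ ε t t' p' p'' := by
  have h1 : 0 ≤ D₁ * ε * (p'' + Real.cos t * t') ^ 2 := by positivity
  have h2 : 0 ≤ D₂ / (2 * ε) * (p' + Real.sin t) ^ 4 :=
    mul_nonneg (by positivity) ((by decide : Even 4).pow_nonneg _)
  have h3 : 0 ≤ 4 * D₂ / ε * (p' + Real.sin t) ^ 2 * Real.sin (t / 2) ^ 4 :=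
    mul_nonneg (by positivity) ((by decide : Even 4).pow_nonneg _)
  rw [density]
  linarith

/-- An inequality between a function and the energy density integrates. -/
lemma IsRep.integral_le_of_le_density (hl : 0 < l) (h : IsRep l T T' P P' P'') {f : ℝ → ℝ} {E : ℝ}
    (hE : ∫ x in I l, density D₁ D₂ σ ε (T x) (T' x) (P' x) (P'' x) ≤ E)
    (hf : IntervalIntegrable f volume (-l) l)
    (hle : ∀ x, f x ≤ density D₁ D₂ σ ε (T x) (T' x) (P' x) (P'' x)) :
    ∫ x in (-l)..l, f x ≤ E := by
  rw [setIntegral_I hl] at hE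
  exact (intervalIntegral.integral_mono (by linarith) hf (h.intervalIntegrable_density hl) hle).trans hE

lemma IsRep.integral_W_le (hD₁ : 0 ≤ D₁) (hD₂ : 0 ≤ D₂) (hl : 0 < l) (hε : 0 < ε)
    (h : IsRep l T T' P P' P'') {E : ℝ}
    (hE : ∫ x in I l, density D₁ D₂ σ ε (T x) (T' x) (P' x) (P'' x) ≤ E) :
    ∫ x in (-l)..l, W D₂ σ (T x) ≤ ε * E := by
  have h1 := h.integral_le_of_le_density hl hE (f := fun x => ε⁻¹ * W D₂ σ (T x))
    ((continuous_const.mul (continuous_W.comp h.primT.continuous)).intervalIntegrable _ _) (fun x => by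
      have := le_density hD₁ hD₂ hε (σ := σ) (T x) (T' x) (P' x) (P'' x)
      have h2 : 0 ≤ 1 / ε * (P' x + Real.sin (T x)) ^ 2 + ε * T' x ^ 2 := by positivity
      rw [one_div] at *; linarith)
  rw [intervalIntegral.integral_const_mul, inv_mul_le_iff₀ hε] at h1
  exact h1

lemma IsRep.integral_abs_le (hD₁ : 0 ≤ D₁) (hD₂ : 0 ≤ D₂) (hσ : 0 < σ) (hl : 0 < l) (hε : 0 < ε)
    (h : IsRep l T T' P P' P'') {E α : ℝ} (hα : 0 < α)
    (hE : ∫ x in I l, density D₁ D₂ σ ε (T x) (T' x) (P' x) (P'' x) ≤ E) :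
    ∫ x in (-l)..l, |P' x + Real.sin (T x)| ≤ l * α + ε * E / (2 * α) := by
  have hs : Continuous fun x => P' x + Real.sin (T x) :=
    h.primP'.continuous.add (Real.continuous_sin.comp h.primT.continuous)
  have h1 := h.integral_le_of_le_density hl hE (f := fun x => ε⁻¹ * (P' x + Real.sin (T x)) ^ 2)
    ((continuous_const.mul (hs.pow 2)).intervalIntegrable _ _) (fun x => by
      have := le_density hD₁ hD₂ hε (σ := σ) (T x) (T' x) (P' x) (P'' x)
      have h2 : 0 ≤ ε * T' x ^ 2 + 1 / ε * W D₂ σ (T x) := by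
        have := W_nonneg hD₂ hσ (T x); positivity
      rw [one_div] at *; linarith)
  rw [intervalIntegral.integral_const_mul, inv_mul_le_iff₀ hε] at h1
  have h2 : ∫ x in (-l)..l, |P' x + Real.sin (T x)| ≤
      ∫ x in (-l)..l, (α / 2 + (2 * α)⁻¹ * (P' x + Real.sin (T x)) ^ 2) := by
    refine intervalIntegral.integral_mono (by linarith) (hs.abs.intervalIntegrable _ _)
      ((continuous_const.add (continuous_const.mul (hs.pow 2))).intervalIntegrable _ _) fun x => ?_
    simp only
    rw [← sq_abs (P' x + _)]
    set s := |P' x + Real.sin (T x)|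
    have h3 : α / 2 + (2 * α)⁻¹ * s ^ 2 - s = (2 * α)⁻¹ * (s - α) ^ 2 := by field_simp; ring
    have h4 : 0 ≤ (2 * α)⁻¹ * (s - α) ^ 2 := by positivity
    linarith
  have hi2 : IntervalIntegrable (fun x => (2 * α)⁻¹ * (P' x + Real.sin (T x)) ^ 2) volume (-l) l :=
    (continuous_const.mul (hs.pow 2)).intervalIntegrable _ _
  rw [intervalIntegral.integral_add intervalIntegrable_const hi2, intervalIntegral.integral_const,
    intervalIntegral.integral_const_mul, smul_eq_mul] at h2
  have h3 := mul_le_mul_of_nonneg_left h1 (by positivity : 0 ≤ (2 * α)⁻¹)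
  rw [div_eq_inv_mul]
  linarith

/-- The Modica–Mortola density of `T`. -/
lemma IsRep.exists_variation (hD₁ : 0 ≤ D₁) (hD₂ : 0 ≤ D₂) (hσ : 0 < σ) (hl : 0 < l) (hε : 0 < ε)
    (h : IsRep l T T' P P' P'') {E : ℝ}
    (hE : ∫ x in I l, density D₁ D₂ σ ε (T x) (T' x) (P' x) (P'' x) ≤ E) :
    ∃ e : ℝ → ℝ, (∀ a b, IntervalIntegrable e volume a b) ∧
      (∀ r, ∫ x in r..(r + 2 * l), e x ≤ E) ∧
      ∀ x y, x ≤ y → |Φ D₂ σ (T y) - Φ D₂ σ (T x)| ≤ ∫ t in x..y, e t := by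
  have hc := h.primT.comp (f := Φ D₂ σ) hasDerivAt_Φ (continuous_const.mul continuous_sqrt_W)
  have hi : ∀ a b, IntervalIntegrable (fun x => |2 * √(W D₂ σ (T x)) * T' x|) volume a b :=
    fun a b => (hc.intInt a b).abs
  refine ⟨fun x => |2 * √(W D₂ σ (T x)) * T' x|, hi, fun r => ?_, fun x y hxy => ?_⟩
  · have hp : Function.Periodic (fun x => |2 * √(W D₂ σ (T x)) * T' x|) (2 * l) := fun x => by
      simp only [h.perT x, h.perT' x]
    rw [hp.intervalIntegral_add_eq r (-l), show -l + 2 * l = l by ring]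
    refine h.integral_le_of_le_density hl hE (hi _ _) fun x => ?_
    refine le_trans ?_ (le_density hD₁ hD₂ hε _ _ _ _)
    have hk : √(W D₂ σ (T x)) ^ 2 = W D₂ σ (T x) := Real.sq_sqrt (W_nonneg hD₂ hσ _)
    rw [← hk, Real.sqrt_sq (Real.sqrt_nonneg _)]
    set k := √(W D₂ σ (T x))
    have hk0 : 0 ≤ k := Real.sqrt_nonneg _
    rw [abs_mul, abs_mul, abs_two, abs_of_nonneg hk0, ← sq_abs (T' x)]
    have h1 : ε * |T' x| ^ 2 + 1 / ε * k ^ 2 - 2 * k * |T' x| = 1 / ε * (ε * |T' x| - k) ^ 2 := by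
      field_simp; ring
    have h2 : 0 ≤ 1 / ε * (ε * |T' x| - k) ^ 2 := by positivity
    have h3 : 0 ≤ 1 / ε * (P' x + Real.sin (T x)) ^ 2 := by positivity
    linarith
  · rw [hc.sub_eq x y]
    exact intervalIntegral.abs_integral_le_integral_abs hxy

/-- A periodic function whose variation between two levels is less than that of four crossings has
its superlevel set contained in an arc which avoids its sublevel set. -/
lemma exists_arc (hl : 0 < l) {f e : ℝ → ℝ} {s₁ s₂ E K : ℝ} (hs : s₁ < s₂) (hT : Continuous T)
    (hp : Function.Periodic T (2 * l)) (hf : Monotone f) (he : ∀ a b, IntervalIntegrable e volume a b)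
    (hE : ∀ r, ∫ x in r..(r + 2 * l), e x ≤ E) (hK : K ≤ f s₂ - f s₁) (hEK : E < 4 * K)
    (hv : ∀ x y, x ≤ y → |f (T y) - f (T x)| ≤ ∫ t in x..y, e t) :
    ∃ m h : ℝ, ∀ y, |y| ≤ l → (|y| ≤ h → s₁ < T (m + y)) ∧ (h < |y| → T (m + y) < s₂) := by
  by_cases h1 : ∃ r, T r ≤ s₁
  swap
  · push Not at h1
    exact ⟨0, l, fun y hy => ⟨fun _ => h1 _, fun h => absurd hy (not_le.2 h)⟩⟩
  by_cases h2 : ∃ p, s₂ ≤ T p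
  swap
  · push Not at h2
    exact ⟨0, -1, fun y hy => ⟨fun h => absurd (abs_nonneg y) (by linarith), fun _ => h2 _⟩⟩
  obtain ⟨r, hr⟩ := h1
  obtain ⟨p₀, hp₀⟩ := h2
  set A := Icc r (r + 2 * l) ∩ {x | s₂ ≤ T x} with hA
  have hAc : IsCompact A := isCompact_Icc.inter_right (isClosed_le continuous_const hT)
  have hAn : A.Nonempty := by
    obtain ⟨y, hy, hxy⟩ := hp.exists_mem_Ico (by linarith) p₀ r
    exact ⟨y, ⟨hy.1, hy.2.le⟩, by rw [mem_ofPred_eq, ← hxy]; exact hp₀⟩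
  obtain ⟨p, hpA, hpmin⟩ := hAc.exists_isLeast hAn
  obtain ⟨q, hqA, hqmax⟩ := hAc.exists_isGreatest hAn
  have hpT : s₂ ≤ T p := hpA.2
  have hqT : s₂ ≤ T q := hqA.2
  have hpq : p ≤ q := hpmin hqA
  have hrp : r < p := lt_of_le_of_ne hpA.1.1 fun h => by rw [← h] at hpT; linarith
  have hqr : q < r + 2 * l := lt_of_le_of_ne hqA.1.2 fun h => by
    rw [h, hp r] at hqT; linarith
  have hcross : ∀ x y, x ≤ y → (T x ≤ s₁ ∧ s₂ ≤ T y) ∨ (s₂ ≤ T x ∧ T y ≤ s₁) →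
      K ≤ ∫ t in x..y, e t := by
    intro x y hxy h
    refine le_trans ?_ (hv x y hxy)
    rcases h with ⟨h1, h2⟩ | ⟨h1, h2⟩
    · exact le_trans (by linarith [hf h1, hf h2]) (le_abs_self _)
    · exact le_trans (by linarith [hf h1, hf h2]) (neg_le_abs _)
  have hmid : ∀ x ∈ Icc p q, s₁ < T x := by
    intro x hx
    by_contra! hx1
    have a1 := hcross r p hrp.le (Or.inl ⟨hr, hpT⟩)
    have a2 := hcross p x hx.1 (Or.inr ⟨hpT, hx1⟩)
    have a3 := hcross x q hx.2 (Or.inl ⟨hx1, hqT⟩)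
    have a4 := hcross q (r + 2 * l) hqr.le (Or.inr ⟨hqT, by rw [hp r]; exact hr⟩)
    have b1 := intervalIntegral.integral_add_adjacent_intervals (he r p) (he p x)
    have b2 := intervalIntegral.integral_add_adjacent_intervals (he r x) (he x q)
    have b3 := intervalIntegral.integral_add_adjacent_intervals (he r q) (he q (r + 2 * l))
    linarith [hE r]
  have hout : ∀ x ∈ Icc r (r + 2 * l), x ∉ Icc p q → T x < s₂ := by
    intro x hx hxn
    by_contra! hc
    exact hxn ⟨hpmin ⟨hx, hc⟩, hqmax ⟨hx, hc⟩⟩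
  refine ⟨(p + q) / 2, (q - p) / 2, fun y hy => ⟨fun h => hmid _ ?_, fun h => ?_⟩⟩
  · rw [abs_le] at h; constructor <;> linarith
  · rw [abs_le] at hy
    rcases lt_abs.1 h with h | h
    · by_cases hx : (p + q) / 2 + y ≤ r + 2 * l
      · exact hout _ ⟨by linarith, hx⟩ fun h' => by linarith [h'.2]
      · rw [← hp.sub_eq]
        exact hout _ ⟨by linarith, by linarith⟩ fun h' => by linarith [h'.1]
    · by_cases hx : r ≤ (p + q) / 2 + y
      · exact hout _ ⟨hx, by linarith⟩ fun h' => by linarith [h'.1]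
      · rw [← hp]
        exact hout _ ⟨by linarith, by linarith⟩ fun h' => by linarith [h'.2]

/-- Points of small potential are close to the wells. -/
lemma exists_well_modulus (hD₂ : 0 ≤ D₂) (hσ : 0 < σ) {η : ℝ} (hη : 0 < η) :
    ∃ w > 0, ∀ t, |t| ≤ Real.pi → W D₂ σ t < w → |t - β D₂ σ| < η ∨ |t + β D₂ σ| < η := by
  obtain ⟨-, -, hz⟩ := β_spec hD₂ hσ
  set A := Icc (-Real.pi) Real.pi ∩ {t | η ≤ |t - β D₂ σ|} ∩ {t | η ≤ |t + β D₂ σ|} with hA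
  have hAc : IsCompact A := (isCompact_Icc.inter_right (isClosed_le continuous_const (by fun_prop))).inter_right
    (isClosed_le continuous_const (by fun_prop))
  rcases A.eq_empty_or_nonempty with h0 | hn
  · refine ⟨1, one_pos, fun t ht _ => ?_⟩
    by_contra! hc
    exact (h0 ▸ (⟨⟨abs_le.1 ht, hc.1⟩, hc.2⟩ : t ∈ A) : t ∈ (∅ : Set ℝ))
  · obtain ⟨t₀, ht₀, hmin⟩ := hAc.exists_isMinOn hn (continuous_W (D₂ := D₂) (σ := σ)).continuousOn
    refine ⟨W D₂ σ t₀, lt_of_le_of_ne (W_nonneg hD₂ hσ _) fun h => ?_, fun t ht hlt => ?_⟩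
    · rcases (hz t₀ ht₀.1.1).1 h.symm with h | h
      · have := ht₀.1.2; rw [mem_ofPred_eq, h, sub_self, abs_zero] at this; linarith
      · have := ht₀.2; rw [mem_ofPred_eq, h, neg_add_cancel, abs_zero] at this; linarith
    · by_contra! hc
      exact absurd (hmin (⟨⟨abs_le.1 ht, hc.1⟩, hc.2⟩ : t ∈ A)) (not_le.2 hlt)

/-- The even two-valued profile equal to `b` on `[-h, h]`. -/
noncomputable def step (b h y : ℝ) : ℝ := if |y| ≤ h then b else -b

lemma measurable_step (b h : ℝ) : Measurable (step b h) :=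
  Measurable.ite (measurableSet_le (by fun_prop) measurable_const) measurable_const measurable_const

lemma measurable_chevron (l b : ℝ) : Measurable (chevron l b) :=
  Measurable.ite measurableSet_Ioo measurable_const measurable_const

lemma abs_step (b h y : ℝ) : |step b h y| = |b| := by unfold step; split_ifs <;> simp

lemma abs_chevron (l b y : ℝ) : |chevron l b y| = |b| := by unfold chevron; split_ifs <;> simp

lemma intervalIntegrable_of_bdd {f : ℝ → ℝ} {C : ℝ} (hf : Measurable f) (h : ∀ x, |f x| ≤ C) (a b : ℝ) :
    IntervalIntegrable f volume a b :=
  (intervalIntegrable_const (c := C)).mono_fun' hf.aestronglyMeasurable (ae_of_all _ h)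

lemma chevron_eq (l b : ℝ) : chevron l b = fun x => (Ioo (-l / 2) (l / 2)).indicator (fun _ => 2 * b) x - b := by
  funext x
  unfold chevron
  by_cases h : x ∈ Ioo (-l / 2) (l / 2)
  · rw [if_pos h, indicator_of_mem h]; ring
  · rw [if_neg h, indicator_of_notMem h]; ring

lemma integral_chevron (hl : 0 < l) (b : ℝ) : ∫ x in (-l)..l, chevron l b x = 0 := by
  have hsub : Ioc (-l) l ∩ Ioo (-l / 2) (l / 2) = Ioo (-l / 2) (l / 2) :=
    inter_eq_right.2 fun x hx => ⟨by linarith [hx.1], by linarith [hx.2]⟩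
  have hi : IntervalIntegrable ((Ioo (-l / 2) (l / 2)).indicator fun _ => 2 * b) volume (-l) l :=
    intervalIntegrable_of_bdd (C := |2 * b|) (measurable_const.indicator measurableSet_Ioo)
      (fun x => by by_cases h : x ∈ Ioo (-l / 2) (l / 2) <;> simp [indicator, h]) _ _
  rw [chevron_eq, intervalIntegral.integral_sub hi intervalIntegrable_const,
    intervalIntegral.integral_const, intervalIntegral.integral_of_le (by linarith),
    setIntegral_indicator measurableSet_Ioo, hsub, setIntegral_const, measureReal_def,
    Real.volume_Ioo, ENNReal.toReal_ofReal (by linarith)]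
  simp only [smul_eq_mul]; ring

/-- Two even profiles are ordered, so their distance is controlled by the mean. -/
lemma integral_abs_step_sub_chevron (hl : 0 < l) {b : ℝ} (hb : 0 < b) (h : ℝ) :
    ∫ y in (-l)..l, |step b h y - chevron l b y| = |∫ y in (-l)..l, step b h y| := by
  have hi1 := intervalIntegrable_of_bdd (measurable_step b h) (fun x => (abs_step b h x).le) (-l) l
  have hi2 := intervalIntegrable_of_bdd (measurable_chevron l b) (fun x => (abs_chevron l b x).le) (-l) l
  have hd : ∫ y in (-l)..l, step b h y = ∫ y in (-l)..l, (step b h y - chevron l b y) := by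
    rw [intervalIntegral.integral_sub hi1 hi2, integral_chevron hl, sub_zero]
  have hmem : ∀ y : ℝ, y ∈ Ioo (-l / 2) (l / 2) ↔ |y| < l / 2 := fun y => by
    rw [abs_lt, mem_Ioo, neg_div]
  rw [hd]
  rcases le_or_gt (l / 2) h with hh | hh
  · have : ∀ y, 0 ≤ step b h y - chevron l b y := fun y => by
      unfold step chevron
      simp only [hmem]
      split_ifs <;> linarith
    rw [abs_of_nonneg (intervalIntegral.integral_nonneg (by linarith) fun y _ => this y)]
    simp only [abs_of_nonneg (this _)]
  · have : ∀ y, step b h y - chevron l b y ≤ 0 := fun y => by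
      unfold step chevron
      simp only [hmem]
      split_ifs <;> linarith
    have h2 : ∫ y in (-l)..l, (step b h y - chevron l b y) ≤ 0 := by
      have := intervalIntegral.integral_nonneg (μ := volume) (a := -l) (b := l) (by linarith)
        (fun y _ => neg_nonneg.2 (this y))
      rw [intervalIntegral.integral_neg] at this; linarith
    rw [abs_of_nonpos h2, ← intervalIntegral.integral_neg]
    simp only [abs_of_nonpos (this _)]

end


section
variable {D₁ D₂ σ l ε : ℝ} {T T' P P' P'' : ℝ → ℝ}

/-- The distance of a translate of `T` to the limit profile. -/
noncomputable def translateDist (l b : ℝ) (T : ℝ → ℝ) (c : ℝ) : ℝ :=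
  ∫ x in (-l)..l, |T (x + c) - chevron l b x|

lemma exists_levels (hD₂ : 0 ≤ D₂) (hσ : 0 < σ) : ∃ η > 0, η < β D₂ σ ∧
    3 / 4 * Φ D₂ σ (β D₂ σ) < Φ D₂ σ (β D₂ σ - η) - Φ D₂ σ (-β D₂ σ + η) := by
  have hβ := (β_spec hD₂ hσ).1
  have hΦ := Φ_β_pos hD₂ hσ
  have hc : Continuous fun η => Φ D₂ σ (β D₂ σ - η) - Φ D₂ σ (-β D₂ σ + η) :=
    (continuous_Φ.comp (by fun_prop)).sub (continuous_Φ.comp (by fun_prop))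
  have h0 : 3 / 4 * Φ D₂ σ (β D₂ σ) <
      Φ D₂ σ (β D₂ σ - 0) - Φ D₂ σ (-β D₂ σ + 0) := by
    rw [sub_zero, add_zero, Φ_neg_β]; linarith
  have hev := (hc.continuousAt (x := 0)).eventually_const_lt h0
  obtain ⟨η, h1, h2⟩ := ((hev.filter_mono nhdsWithin_le_nhds).and
    (Ioo_mem_nhdsGT hβ)).exists (f := 𝓝[>] (0 : ℝ))
  exact ⟨η, h2.1, h2.2, h1⟩

lemma abs_sin_sub_sin_le (x y : ℝ) : |Real.sin x - Real.sin y| ≤ |x - y| := by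
  have := Real.lipschitzWith_sin.dist_le_mul x y
  simpa [Real.dist_eq] using this

lemma IsRep.translateDist_le (hD₁ : 0 ≤ D₁) (hD₂ : 0 ≤ D₂) (hσ : 0 < σ) (hl : 0 < l) (hε : 0 < ε)
    (h : IsRep l T T' P P' P'') {E η δ w : ℝ}
    (hE : ∫ x in I l, density D₁ D₂ σ ε (T x) (T' x) (P' x) (P'' x) ≤ E)
    (hηβ : η < β D₂ σ) (hηE : E < 4 * (Φ D₂ σ (β D₂ σ - η) - Φ D₂ σ (-β D₂ σ + η)))
    (hδη : δ ≤ η) (hδ : 0 < δ) (hw : 0 < w)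
    (hwell : ∀ t, |t| ≤ Real.pi → W D₂ σ t < w → |t - β D₂ σ| < δ ∨ |t + β D₂ σ| < δ)
    {X Y : ℝ} (hX : 2 * l * δ + 2 * Real.pi / w * (ε * E) ≤ X)
    (hY : ∫ x in (-l)..l, |P' x + Real.sin (T x)| ≤ Y) :
    ∃ m, translateDist l (β D₂ σ) T m ≤ X + β D₂ σ / Real.sin (β D₂ σ) * (X + Y) := by
  obtain ⟨hβ0, hβπ, -⟩ := β_spec hD₂ hσ
  set b := β D₂ σ with hb
  have hsin : 0 < Real.sin b := Real.sin_pos_of_pos_of_lt_pi hβ0 hβπ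
  have hTc := h.primT.continuous
  obtain ⟨e, he1, he2, he3⟩ := h.exists_variation hD₁ hD₂ hσ hl hε hE
  obtain ⟨m, k, hmk⟩ := exists_arc hl (s₁ := -b + η) (s₂ := b - η) (by linarith) hTc h.perT Φ_mono
    he1 he2 le_rfl hηE he3
  have hTm : Continuous fun y => T (y + m) := hTc.comp (by fun_prop)
  have hshift : ∀ f : ℝ → ℝ, Function.Periodic f (2 * l) →
      ∫ y in (-l)..l, f (y + m) = ∫ y in (-l)..l, f y := fun f hf => by
    rw [intervalIntegral.integral_comp_add_right f m, show l + m = -l + m + 2 * l by ring,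
      hf.intervalIntegral_add_eq _ (-l), show -l + 2 * l = l by ring]
  have hist : IntervalIntegrable (step b k) volume (-l) l :=
    intervalIntegrable_of_bdd (measurable_step b k) (fun x => (abs_step b k x).le) _ _
  have hich : IntervalIntegrable (chevron l b) volume (-l) l :=
    intervalIntegrable_of_bdd (measurable_chevron l b) (fun x => (abs_chevron l b x).le) _ _
  -- the distance to the two-valued profile on the arc
  have hpt : ∀ y ∈ Icc (-l) l, |T (y + m) - step b k y| ≤ δ + 2 * Real.pi / w * W D₂ σ (T (y + m)) := by
    intro y hy
    have hyl : |y| ≤ l := abs_le.2 hy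
    have hW := W_nonneg hD₂ hσ (T (y + m))
    have hπ := h.bound (y + m)
    obtain ⟨a1, a2⟩ := hmk y hyl
    rw [add_comm m y] at a1 a2
    rcases lt_or_ge (W D₂ σ (T (y + m))) w with hlt | hge
    · have hnn : 0 ≤ 2 * Real.pi / w * W D₂ σ (T (y + m)) := by
        have := Real.pi_pos; positivity
      suffices |T (y + m) - step b k y| < δ by linarith
      unfold step
      rcases hwell _ hπ hlt with hcase | hcase
      · rw [if_pos]; · exact hcase
        by_contra hc
        have := a2 (not_le.1 hc)
        linarith [(abs_lt.1 hcase).1]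
      · rw [if_neg]; · rwa [sub_neg_eq_add]
        intro hc
        have := a1 hc
        linarith [(abs_lt.1 hcase).2]
    · have h1 : |T (y + m) - step b k y| ≤ 2 * Real.pi := by
        refine (abs_sub _ _).trans ?_
        rw [abs_step, abs_of_pos hβ0]; linarith
      have h2 : 2 * Real.pi ≤ 2 * Real.pi / w * W D₂ σ (T (y + m)) := by
        rw [div_mul_eq_mul_div, le_div_iff₀ hw]
        exact mul_le_mul_of_nonneg_left hge (by linarith [Real.pi_pos])
      linarith
  have hWc : Continuous fun y => W D₂ σ (T (y + m)) := continuous_W.comp hTm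
  have hi1 : IntervalIntegrable (fun y => |T (y + m) - step b k y|) volume (-l) l :=
    ((hTm.intervalIntegrable _ _).sub hist).abs
  have hd1 : ∫ y in (-l)..l, |T (y + m) - step b k y| ≤ X := by
    have hi2 : IntervalIntegrable (fun y => 2 * Real.pi / w * W D₂ σ (T (y + m))) volume (-l) l :=
      (continuous_const.mul hWc).intervalIntegrable _ _
    have h1 := intervalIntegral.integral_mono_on (μ := volume) (by linarith : -l ≤ l) hi1
      (intervalIntegrable_const.add hi2) hpt
    rw [intervalIntegral.integral_add intervalIntegrable_const hi2,
      intervalIntegral.integral_const, intervalIntegral.integral_const_mul,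
      hshift (fun y => W D₂ σ (T y)) (fun y => by simp only [h.perT y]), smul_eq_mul] at h1
    have h2 := mul_le_mul_of_nonneg_left (h.integral_W_le hD₁ hD₂ hl hε hE)
      (by have := Real.pi_pos; positivity : 0 ≤ 2 * Real.pi / w)
    linarith
  -- the mean of the two-valued profile
  have hsinT : |∫ y in (-l)..l, Real.sin (T (y + m))| ≤ Y := by
    have hsc : Continuous fun y => Real.sin (T y) := Real.continuous_sin.comp hTc
    rw [hshift (fun y => Real.sin (T y)) (fun y => by simp only [h.perT y])]
    have hP0 : ∫ y in (-l)..l, P' y = 0 := by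
      rw [← h.primP.sub_eq, show l = -l + 2 * l by ring, h.perP, show -(-l + 2 * l) = -l by ring, sub_self]
    have : ∫ y in (-l)..l, Real.sin (T y) = ∫ y in (-l)..l, (P' y + Real.sin (T y)) := by
      rw [intervalIntegral.integral_add (h.primP'.continuous.intervalIntegrable _ _)
        (hsc.intervalIntegrable _ _), hP0, zero_add]
    rw [this]
    exact (intervalIntegral.abs_integral_le_integral_abs (by linarith)).trans hY
  have hstep : |∫ y in (-l)..l, step b k y| ≤ b / Real.sin b * (X + Y) := by
    have hss : ∀ y, Real.sin (step b k y) = Real.sin b / b * step b k y := fun y => by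
      unfold step
      split_ifs
      · field_simp
      · rw [Real.sin_neg]; field_simp
    have hisin : IntervalIntegrable (fun y => Real.sin (step b k y)) volume (-l) l := by
      simp only [hss]; exact hist.const_mul _
    have hsTm : Continuous fun y => Real.sin (T (y + m)) := Real.continuous_sin.comp hTm
    have h1 : |(∫ y in (-l)..l, Real.sin (T (y + m))) - ∫ y in (-l)..l, Real.sin (step b k y)| ≤ X := by
      rw [← intervalIntegral.integral_sub (hsTm.intervalIntegrable _ _) hisin]
      refine (intervalIntegral.abs_integral_le_integral_abs (by linarith)).trans (le_trans ?_ hd1)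
      exact intervalIntegral.integral_mono (by linarith)
        ((hsTm.intervalIntegrable _ _).sub hisin).abs hi1 fun y => abs_sin_sub_sin_le _ _
    have h2 : |∫ y in (-l)..l, Real.sin (step b k y)| ≤ X + Y := by
      rw [abs_le] at *
      constructor <;> linarith [h1.1, h1.2, hsinT.1, hsinT.2]
    simp only [hss] at h2
    rw [intervalIntegral.integral_const_mul, abs_mul, abs_of_pos (by positivity),
      div_mul_eq_mul_div, div_le_iff₀ hβ0] at h2
    rw [div_mul_eq_mul_div, le_div_iff₀ hsin]
    linarith
  refine ⟨m, ?_⟩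
  have h3 : translateDist l b T m ≤
      ∫ y in (-l)..l, (|T (y + m) - step b k y| + |step b k y - chevron l b y|) :=
    intervalIntegral.integral_mono (by linarith) ((hTm.intervalIntegrable _ _).sub hich).abs
      (hi1.add (hist.sub hich).abs) fun y => abs_sub_le _ _ _
  rw [intervalIntegral.integral_add hi1 (hist.sub hich).abs,
    integral_abs_step_sub_chevron hl hβ0] at h3
  linarith

/-- Pairs of small parameter and bounded energy are close to a translate of the limit profile. -/
lemma exists_translateDist_lt (hD₁ : 0 ≤ D₁) (hD₂ : 0 ≤ D₂) (hσ : 0 < σ) (hl : 0 < l) {κ : ℝ}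
    (hκ : 0 < κ) : ∃ ε₁ > 0, ∀ ε, 0 < ε → ε < ε₁ → ∀ T T' P P' P'' : ℝ → ℝ,
      IsRep l T T' P P' P'' →
      ∫ x in I l, density D₁ D₂ σ ε (T x) (T' x) (P' x) (P'' x) ≤ 3 * Φ D₂ σ (β D₂ σ) →
      (∃ m, translateDist l (β D₂ σ) T m < κ) ∧ ∫ x in (-l)..l, |P' x + Real.sin (T x)| < κ := by
  obtain ⟨hβ0, hβπ, -⟩ := β_spec hD₂ hσ
  have hΦ := Φ_β_pos hD₂ hσ
  have hsin : 0 < Real.sin (β D₂ σ) := Real.sin_pos_of_pos_of_lt_pi hβ0 hβπ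
  obtain ⟨η, hη0, hηβ, hη⟩ := exists_levels hD₂ hσ
  set K := 1 + β D₂ σ / Real.sin (β D₂ σ) with hK
  have hq : 0 < β D₂ σ / Real.sin (β D₂ σ) := by positivity
  have hK1 : 1 ≤ K := by linarith
  set ν := κ / (4 * K) with hν
  have hν0 : 0 < ν := by positivity
  set δ := min η (ν / (2 * l)) with hδ
  have hδ0 : 0 < δ := lt_min hη0 (by positivity)
  have hδν : 2 * l * δ ≤ ν := by
    have : δ ≤ ν / (2 * l) := min_le_right _ _
    rw [le_div_iff₀ (by positivity)] at this; linarith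
  obtain ⟨w, hw0, hw⟩ := exists_well_modulus hD₂ hσ hδ0
  set E := 3 * Φ D₂ σ (β D₂ σ) with hE
  have hE0 : 0 < E := by positivity
  set α := ν / l with hα
  have hα0 : 0 < α := by positivity
  have hπ := Real.pi_pos
  refine ⟨min (ν / (2 * Real.pi / w * E)) (ν * (2 * α) / E), by positivity,
    fun ε hε hlt T T' P P' P'' h hen => ?_⟩
  have h1 : 2 * Real.pi / w * (ε * E) ≤ ν := by
    have := (hlt.trans_le (min_le_left _ _)).le
    rw [le_div_iff₀ (by positivity)] at this; linarith
  have h2 : ε * E / (2 * α) ≤ ν := by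
    have := (hlt.trans_le (min_le_right _ _)).le
    rw [le_div_iff₀ (by positivity)] at this
    rwa [div_le_iff₀ (by positivity)]
  have hY := h.integral_abs_le hD₁ hD₂ hσ hl hε hα0 hen
  have hlα : l * α = ν := by rw [hα]; field_simp
  have hY' : ∫ x in (-l)..l, |P' x + Real.sin (T x)| ≤ 2 * ν := by linarith
  have h4 : 4 * K * ν = κ := by rw [hν]; field_simp
  refine ⟨?_, by nlinarith⟩
  obtain ⟨m, hm⟩ := h.translateDist_le hD₁ hD₂ hσ hl hε hen hηβ (by rw [hE]; linarith)
    (min_le_left _ _) hδ0 hw0 hw (X := 2 * ν) (by linarith) hY'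
  refine ⟨m, hm.trans_lt ?_⟩
  rw [← h4, hK]
  nlinarith

lemma continuous_translateDist (b : ℝ) {C : ℝ} (hT : Continuous T) (hC : ∀ x, |T x| ≤ C) :
    Continuous (translateDist l b T) := by
  refine intervalIntegral.continuous_of_dominated_interval (bound := fun _ => C + |b|)
    (fun c => ?_) (fun c => ae_of_all _ fun t _ => ?_) intervalIntegrable_const
    (ae_of_all _ fun t _ => ((hT.comp (by fun_prop)).sub continuous_const).abs)
  · exact (((hT.comp (by fun_prop)).measurable.sub (measurable_chevron l b)).abs).aestronglyMeasurable
  · rw [Real.norm_eq_abs, abs_abs]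
    refine (abs_sub _ _).trans ?_
    rw [abs_chevron]
    linarith [hC (t + c)]

/-- A small value of the distance is attained in the open interval. -/
lemma exists_mem_translateDist_lt (hl : 0 < l) (b : ℝ) {C : ℝ} (hT : Continuous T)
    (hC : ∀ x, |T x| ≤ C) (hp : Function.Periodic T (2 * l)) {κ m : ℝ} (hm : translateDist l b T m < κ) :
    ∃ c ∈ Ioo (-l) l, translateDist l b T c < κ := by
  have hper : Function.Periodic (translateDist l b T) (2 * l) := fun c => by
    simp only [translateDist, ← add_assoc, hp _]
  obtain ⟨y, hy, hmy⟩ := hper.exists_mem_Ico (by linarith) m (-l)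
  rw [hmy] at hm
  have hev := ((continuous_translateDist (l := l) b hT hC).continuousAt (x := y)).eventually_lt_const hm
  obtain ⟨c, h1, h2⟩ := ((hev.filter_mono nhdsWithin_le_nhds).and
    (Ioo_mem_nhdsGT (show y < l by linarith [hy.2]))).exists (f := 𝓝[>] y)
  exact ⟨c, ⟨by linarith [hy.1, h2.1], h2.2⟩, h1⟩

/-- Almost optimal translations. -/
lemma exists_almost_min (hl : 0 < l) (b : ℝ) (T : ℝ → ℝ) {ν : ℝ} (hν : 0 < ν) :
    ∃ c ∈ Ioo (-l) l, ∀ c' ∈ Ioo (-l) l, translateDist l b T c ≤ translateDist l b T c' + ν := by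
  set S := translateDist l b T '' Ioo (-l) l with hS
  have hne : S.Nonempty := ⟨_, 0, ⟨by linarith, hl⟩, rfl⟩
  have hbd : BddBelow S := ⟨0, by
    rintro _ ⟨c, -, rfl⟩
    exact intervalIntegral.integral_nonneg (by linarith) fun _ _ => abs_nonneg _⟩
  obtain ⟨_, ⟨c, hc, rfl⟩, hlt⟩ := exists_lt_of_csInf_lt hne (show sInf S < sInf S + ν by linarith)
  exact ⟨c, hc, fun c' hc' => by linarith [csInf_le hbd ⟨c', hc', rfl⟩]⟩

end


section
variable {D₁ D₂ σ l ε : ℝ} {T T' P P' P'' : ℝ → ℝ}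

/-! ### The limit pair -/

/-- The second component of the limit. -/
noncomputable def glim (l b x : ℝ) : ℝ := ∫ t in (0 : ℝ)..x, -Real.sin (chevron l b t)

lemma intervalIntegrable_sin_chevron (l b x y : ℝ) :
    IntervalIntegrable (fun t => Real.sin (chevron l b t)) volume x y :=
  intervalIntegrable_of_bdd (Real.measurable_sin.comp (measurable_chevron l b))
    (fun _ => Real.abs_sin_le_one _) x y

lemma isPrim_glim (l b : ℝ) : IsPrim (glim l b) (fun x => -Real.sin (chevron l b x)) :=
  ⟨locallyIntegrable_of_intervalIntegrable fun _ _ => (intervalIntegrable_sin_chevron l b _ _).neg,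
    fun _ _ => intervalIntegral.integral_interval_sub_left
      (intervalIntegrable_sin_chevron l b _ _).neg (intervalIntegrable_sin_chevron l b _ _).neg⟩

lemma chevron_neg (l b x : ℝ) : chevron l b (-x) = chevron l b x := by
  have : -x ∈ Ioo (-l / 2) (l / 2) ↔ x ∈ Ioo (-l / 2) (l / 2) := by
    simp only [mem_Ioo]; constructor <;> rintro ⟨h1, h2⟩ <;> constructor <;> linarith
  simp only [chevron, this]

lemma glim_neg (l b x : ℝ) : glim l b (-x) = -glim l b x := by
  have h := intervalIntegral.integral_comp_neg (a := 0) (b := x)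
    (fun t => -Real.sin (chevron l b t))
  simp only [chevron_neg, neg_zero] at h
  rw [glim, glim, h, intervalIntegral.integral_symm]

lemma integral_glim (l b : ℝ) : ∫ x in (-l)..l, glim l b x = 0 := by
  have h := intervalIntegral.integral_comp_neg (a := -l) (b := l) (glim l b)
  simp only [glim_neg, neg_neg, intervalIntegral.integral_neg] at h
  linarith

lemma integral_comp_add_of_periodic {f : ℝ → ℝ} (hf : Function.Periodic f (2 * l)) (c : ℝ) :
    ∫ y in (-l)..l, f (y + c) = ∫ y in (-l)..l, f y := by
  rw [intervalIntegral.integral_comp_add_right f c, show l + c = -l + c + 2 * l by ring,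
    hf.intervalIntegral_add_eq _ (-l), show -l + 2 * l = l by ring]

/-- Uniform convergence of the second component. -/
lemma IsRep.abs_sub_glim_le (hl : 0 < l) (h : IsRep l T T' P P' P'') {b c τ : ℝ}
    (hτ : translateDist l b T c + ∫ x in (-l)..l, |P' x + Real.sin (T x)| ≤ τ)
    {x : ℝ} (hx : x ∈ Icc (-l) l) : |P (x + c) - mean l P - glim l b x| ≤ τ := by
  have hTc : Continuous fun t => T (t + c) := h.primT.continuous.comp (by fun_prop)
  have hPc : Continuous fun t => P (t + c) := h.primP.continuous.comp (by fun_prop)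
  have hP'c : Continuous fun t => P' (t + c) := h.primP'.continuous.comp (by fun_prop)
  have hgc := (isPrim_glim l b).continuous
  have hρ : Continuous fun t => P' t + Real.sin (T t) :=
    h.primP'.continuous.add (Real.continuous_sin.comp h.primT.continuous)
  have hρc : Continuous fun t => P' (t + c) + Real.sin (T (t + c)) := hρ.comp (by fun_prop : Continuous fun t => t + c)
  have hich : IntervalIntegrable (chevron l b) volume (-l) l :=
    intervalIntegrable_of_bdd (measurable_chevron l b) (fun x => (abs_chevron l b x).le) _ _
  set D : ℝ → ℝ := fun x => P (x + c) - mean l P - glim l b x with hD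
  have hDc : Continuous D := (hPc.sub continuous_const).sub hgc
  have hosc : ∀ y ∈ Icc (-l) l, |D x - D y| ≤ τ := by
    intro y hy
    have e1 : D x - D y = ∫ t in y..x, (P' (t + c) + Real.sin (chevron l b t)) := by
      have h1 := h.primP.sub_eq (y + c) (x + c)
      rw [← intervalIntegral.integral_comp_add_right] at h1
      have h2 := (isPrim_glim l b).sub_eq y x
      rw [intervalIntegral.integral_neg] at h2
      rw [intervalIntegral.integral_add (hP'c.intervalIntegrable _ _) (intervalIntegrable_sin_chevron l b _ _)]
      simp only [hD]; linarith
    have hi : ∀ a b', IntervalIntegrable (fun t => |P' (t + c) + Real.sin (chevron l b t)|) volume a b' :=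
      fun a b' => ((hP'c.intervalIntegrable _ _).add (intervalIntegrable_sin_chevron l b _ _)).abs
    have hd : IntervalIntegrable (fun t => |T (t + c) - chevron l b t|) volume (-l) l :=
      ((hTc.intervalIntegrable _ _).sub hich).abs
    have e2 : |∫ t in y..x, (P' (t + c) + Real.sin (chevron l b t))| ≤
        |(∫ t in (-l)..l, |P' (t + c) + Real.sin (chevron l b t)| )| := by
      refine (intervalIntegral.norm_integral_le_abs_integral_norm (μ := volume) (a := y) (b := x)
        (f := fun t => P' (t + c) + Real.sin (chevron l b t))).trans ?_
      refine intervalIntegral.abs_integral_mono_interval ?_ (ae_of_all _ fun _ => abs_nonneg _) (hi _ _)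
      rw [uIoc_of_le (by linarith : -l ≤ l)]
      exact Ioc_subset_Ioc (le_min hy.1 hx.1) (max_le hy.2 hx.2)
    rw [abs_of_nonneg (intervalIntegral.integral_nonneg (by linarith) fun _ _ => abs_nonneg _)] at e2
    have e3 : ∫ t in (-l)..l, |P' (t + c) + Real.sin (chevron l b t)| ≤
        ∫ t in (-l)..l, (|T (t + c) - chevron l b t| + |P' (t + c) + Real.sin (T (t + c))|) := by
      refine intervalIntegral.integral_mono (by linarith) (hi _ _)
        (hd.add (hρc.abs.intervalIntegrable _ _)) fun t => ?_
      have e4 := abs_sin_sub_sin_le (T (t + c)) (chevron l b t)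
      have e5 : P' (t + c) + Real.sin (chevron l b t) = (P' (t + c) + Real.sin (T (t + c))) -
        (Real.sin (T (t + c)) - Real.sin (chevron l b t)) := by ring
      simp only
      rw [e5]
      exact (abs_sub _ _).trans (by linarith)
    rw [intervalIntegral.integral_add hd (hρc.abs.intervalIntegrable _ _),
      integral_comp_add_of_periodic (f := fun t => |P' t + Real.sin (T t)|)
        (fun t => by simp only [h.perT t, h.perP' t]) c] at e3
    rw [e1]
    rw [translateDist] at hτ
    linarith
  have hmean : ∫ y in (-l)..l, D y = 0 := by
    simp only [hD]
    have hPm : IntervalIntegrable (fun y => P (y + c) - mean l P) volume (-l) l :=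
      (hPc.sub continuous_const).intervalIntegrable _ _
    rw [intervalIntegral.integral_sub hPm (hgc.intervalIntegrable _ _),
      intervalIntegral.integral_sub (hPc.intervalIntegrable _ _)
      intervalIntegrable_const, integral_glim, integral_comp_add_of_periodic h.perP,
      intervalIntegral.integral_const, mean, setIntegral_I hl, smul_eq_mul]
    field_simp; ring
  have hint : 2 * l * D x = ∫ y in (-l)..l, (D x - D y) := by
    rw [intervalIntegral.integral_sub intervalIntegrable_const (hDc.intervalIntegrable _ _), hmean,
      intervalIntegral.integral_const, smul_eq_mul]
    ring
  have hnorm : ‖∫ y in (-l)..l, (D x - D y)‖ ≤ τ * |l - -l| := by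
    refine intervalIntegral.norm_integral_le_of_norm_le_const fun y hy => ?_
    rw [uIoc_of_le (by linarith)] at hy
    exact hosc y ⟨hy.1.le, hy.2⟩
  rw [← hint, Real.norm_eq_abs, abs_mul, abs_of_pos (show 0 < 2 * l by linarith), sub_neg_eq_add,
    abs_of_pos (show 0 < l + l by linarith)] at hnorm
  have h2 : 2 * l * |D x| ≤ 2 * l * τ := by linarith
  exact le_of_mul_le_mul_left h2 (by linarith)

lemma totalVar_congr {u v : ℝ → ℝ} (h : u =ᵐ[volume.restrict (I l)] v) : totalVar l u = totalVar l v := by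
  unfold totalVar
  refine iSup_congr fun φ => iSup_congr fun _ => ?_
  congr 1
  exact integral_congr_ae (h.mul (ae_eq_refl _))

/-- The function with value `A` on `(-l/2, l/2)` and `B` elsewhere. -/
noncomputable def plateau (l A B x : ℝ) : ℝ := if x ∈ Ioo (-l / 2) (l / 2) then A else B

lemma integral_plateau_mul_deriv (hl : 0 < l) (A B : ℝ) {φ : ℝ → ℝ} (hφ : ContDiff ℝ 1 φ)
    (hc : HasCompactSupport φ) (hs : tsupport φ ⊆ I l) :
    ∫ x in I l, plateau l A B x * deriv φ x = (A - B) * (φ (l / 2) - φ (-l / 2)) := by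
  obtain ⟨r, hr0, hr, hK⟩ := exists_subset_Icc_of_isCompact hl hc hs
  have hz : ∀ x, r < |x| → φ x = 0 := fun x hx => image_eq_zero_of_notMem_tsupport fun hx' =>
    absurd (abs_le.2 (hK hx')) (not_le.2 hx)
  have hd : Continuous (deriv φ) := hφ.continuous_deriv le_rfl
  have hi := hd.intervalIntegrable (μ := volume)
  have hftc : ∀ a b, ∫ x in a..b, deriv φ x = φ b - φ a := fun a b =>
    intervalIntegral.integral_deriv_eq_sub (fun x _ => (hφ.differentiable one_ne_zero) x) (hi a b)
  have hpl : ∀ x, plateau l A B x * deriv φ x =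
      (Ioo (-l / 2) (l / 2)).indicator (fun x => (A - B) * deriv φ x) x + B * deriv φ x := fun x => by
    unfold plateau
    by_cases h : x ∈ Ioo (-l / 2) (l / 2)
    · rw [if_pos h, indicator_of_mem h]; ring
    · rw [if_neg h, indicator_of_notMem h]; ring
  have hsub : I l ∩ Ioo (-l / 2) (l / 2) = Ioo (-l / 2) (l / 2) :=
    inter_eq_right.2 fun x hx => ⟨by linarith [hx.1], by linarith [hx.2]⟩
  have hB : IntegrableOn (fun x => B * deriv φ x) (I l) := (integrableOn_I hl).2 ((hi _ _).const_mul B)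
  have hA : IntegrableOn (fun x => (A - B) * deriv φ x) (I l) :=
    (integrableOn_I hl).2 ((hi _ _).const_mul (A - B))
  simp only [hpl]
  rw [integral_add (Integrable.indicator hA measurableSet_Ioo) hB, setIntegral_indicator measurableSet_Ioo,
    hsub, setIntegral_I hl, intervalIntegral.integral_const_mul, hftc,
    hz l (by rwa [abs_of_pos hl]), hz (-l) (by rwa [abs_neg, abs_of_pos hl]),
    ← integral_Ioc_eq_integral_Ioo, ← intervalIntegral.integral_of_le (by linarith),
    intervalIntegral.integral_const_mul, hftc]
  ring

lemma totalVar_plateau_le (hl : 0 < l) (A B : ℝ) :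
    totalVar l (plateau l A B) ≤ ENNReal.ofReal (2 * |A - B|) := by
  refine iSup₂_le fun φ hφ => ENNReal.ofReal_le_ofReal ?_
  obtain ⟨h1, h2, h3, h4⟩ := hφ
  rw [integral_plateau_mul_deriv hl A B h1 h2 h3]
  refine (le_abs_self _).trans ?_
  rw [abs_mul, mul_comm]
  refine mul_le_mul_of_nonneg_right ((abs_sub _ _).trans ?_) (abs_nonneg _)
  linarith [h4 (l / 2), h4 (-l / 2)]

lemma totalVar_plateau (hl : 0 < l) {A B : ℝ} (hAB : B ≤ A) :
    totalVar l (plateau l A B) = ENNReal.ofReal (2 * (A - B)) := by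
  refine le_antisymm ((totalVar_plateau_le hl A B).trans_eq (by rw [abs_of_nonneg (by linarith)])) ?_
  let f₁ : ContDiffBump (l / 2) := ⟨l / 8, l / 4, by linarith, by linarith⟩
  let f₂ : ContDiffBump (-l / 2) := ⟨l / 8, l / 4, by linarith, by linarith⟩
  have hts₁ : tsupport f₁ ⊆ I l := by
    rw [f₁.tsupport_eq, Real.closedBall_eq_Icc]
    exact Icc_subset_Ioo (by simp [f₁]; linarith) (by simp [f₁]; linarith)
  have hts₂ : tsupport f₂ ⊆ I l := by
    rw [f₂.tsupport_eq, Real.closedBall_eq_Icc]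
    exact Icc_subset_Ioo (by simp [f₂]; linarith) (by simp [f₂]; linarith)
  have hsub : tsupport (fun x => f₁ x - f₂ x) ⊆ tsupport f₁ ∪ tsupport f₂ := by
    refine closure_minimal (fun x hx => ?_) ((isClosed_tsupport _).union (isClosed_tsupport _))
    by_contra hn
    rw [mem_union, not_or] at hn
    apply hx
    simp [image_eq_zero_of_notMem_tsupport hn.1, image_eq_zero_of_notMem_tsupport hn.2]
  have hcs : HasCompactSupport fun x => f₁ x - f₂ x :=
    (f₁.hasCompactSupport.isCompact.union f₂.hasCompactSupport.isCompact).of_isClosed_subset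
      (isClosed_tsupport _) hsub
  have hcd : ContDiff ℝ 1 fun x => f₁ x - f₂ x := f₁.contDiff.sub f₂.contDiff
  have hmem : (fun x => f₁ x - f₂ x) ∈ {φ : ℝ → ℝ | ContDiff ℝ 1 φ ∧ HasCompactSupport φ ∧
      tsupport φ ⊆ I l ∧ ∀ x, |φ x| ≤ 1} := by
    refine ⟨hcd, hcs, hsub.trans (union_subset hts₁ hts₂), fun x => abs_le.2 ?_⟩
    constructor <;> linarith [f₁.nonneg (x := x), f₁.le_one (x := x), f₂.nonneg (x := x), f₂.le_one (x := x)]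
  refine le_trans ?_ (le_iSup₂ (f := fun (φ : ℝ → ℝ) (_ : φ ∈ {φ : ℝ → ℝ | ContDiff ℝ 1 φ ∧
    HasCompactSupport φ ∧ tsupport φ ⊆ I l ∧ ∀ x, |φ x| ≤ 1}) =>
    ENNReal.ofReal (∫ x in I l, plateau l A B x * deriv φ x)) _ hmem)
  refine ENNReal.ofReal_le_ofReal ?_
  rw [integral_plateau_mul_deriv hl A B hcd hcs (hsub.trans (union_subset hts₁ hts₂))]
  have v1 : f₁ (l / 2) = 1 := f₁.one_of_mem_closedBall (Metric.mem_closedBall_self (by simp [f₁]; linarith))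
  have v2 : f₂ (-l / 2) = 1 := f₂.one_of_mem_closedBall (Metric.mem_closedBall_self (by simp [f₂]; linarith))
  have v3 : f₁ (-l / 2) = 0 := f₁.zero_of_le_dist (by
    rw [Real.dist_eq, show -l / 2 - l / 2 = -l by ring, abs_neg, abs_of_pos hl]; simp [f₁]; linarith)
  have v4 : f₂ (l / 2) = 0 := f₂.zero_of_le_dist (by
    rw [Real.dist_eq, show l / 2 - -l / 2 = l by ring, abs_of_pos hl]; simp [f₂]; linarith)
  rw [v1, v2, v3, v4]
  linarith

lemma comp_chevron (f : ℝ → ℝ) (l b : ℝ) : (fun x => f (chevron l b x)) = plateau l (f b) (f (-b)) := by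
  funext x
  simp only [chevron, plateau]
  split_ifs <;> rfl

lemma traceLeft_chevron (hl : 0 < l) (b : ℝ) : traceLeft l (chevron l b) = -b := by
  refine Tendsto.limUnder_eq (tendsto_const_nhds.congr' ?_)
  filter_upwards [Ioo_mem_nhdsGT (show (0 : ℝ) < l / 2 by linarith)] with ρ hρ
  have h1 := hρ.1
  have h2 := hρ.2
  have : ∫ s in (-l)..(-l + ρ), chevron l b s = ∫ s in (-l)..(-l + ρ), -b := by
    refine intervalIntegral.integral_congr fun s hs => ?_
    rw [uIcc_of_le (by linarith)] at hs
    exact if_neg fun h => by linarith [h.1, hs.2]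
  rw [this, intervalIntegral.integral_const, smul_eq_mul]
  field_simp; ring

lemma traceRight_chevron (hl : 0 < l) (b : ℝ) : traceRight l (chevron l b) = -b := by
  refine Tendsto.limUnder_eq (tendsto_const_nhds.congr' ?_)
  filter_upwards [Ioo_mem_nhdsGT (show (0 : ℝ) < l / 2 by linarith)] with ρ hρ
  have h1 := hρ.1
  have h2 := hρ.2
  have : ∫ s in (l - ρ)..l, chevron l b s = ∫ s in (l - ρ)..l, -b := by
    refine intervalIntegral.integral_congr fun s hs => ?_
    rw [uIcc_of_le (by linarith)] at hs
    exact if_neg fun h => by linarith [h.2, hs.1]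
  rw [this, intervalIntegral.integral_const, smul_eq_mul]
  field_simp; ring

lemma memA_chevron (hl : 0 < l) : MemA D₂ σ l (chevron l (β D₂ σ)) (glim l (β D₂ σ)) := by
  set b := β D₂ σ
  have hprim := isPrim_glim l b
  have hwd := hprim.weakDeriv_ae_eq hl
  have hfin : IsFiniteMeasure (volume.restrict (I l)) := ⟨by simp [I]⟩
  have hL2 : MemL l 2 fun x => -Real.sin (chevron l b x) :=
    MemLp.of_bound (Real.measurable_sin.comp (measurable_chevron l b)).neg.aestronglyMeasurable 1
      (ae_of_all _ fun x => by rw [norm_neg]; exact Real.abs_sin_le_one _)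
  refine ⟨⟨?_, ?_⟩, ae_of_all _ fun x => ?_, hprim.memW12 hl hL2, ⟨?_, ?_⟩, ?_, ?_⟩
  · exact (integrableOn_I hl).2 (intervalIntegrable_of_bdd (measurable_chevron l b)
      (fun x => (abs_chevron l b x).le) _ _)
  · have := comp_chevron (fun x => x) l b
    rw [show chevron l b = plateau l b (-b) from this]
    exact (totalVar_plateau_le hl _ _).trans_lt ENNReal.ofReal_lt_top
  · unfold chevron
    split_ifs
    · exact Or.inl rfl
    · exact Or.inr rfl
  · exact (hL2.integrableOn one_le_two).congr hwd.symm
  · rw [totalVar_congr hwd, comp_chevron (fun x => -Real.sin x)]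
    exact (totalVar_plateau_le hl _ _).trans_lt ENNReal.ofReal_lt_top
  · filter_upwards [hwd] with x hx
    rw [hx]; ring
  · rw [setIntegral_I hl, integral_chevron hl]

lemma G₀_chevron (hD₂ : 0 ≤ D₂) (hσ : 0 < σ) (hl : 0 < l) :
    G₀ D₂ σ l (chevron l (β D₂ σ)) (glim l (β D₂ σ)) = ENNReal.ofReal (2 * Φ D₂ σ (β D₂ σ)) := by
  rw [G₀, if_pos (memA_chevron hl), comp_chevron, traceLeft_chevron hl, traceRight_chevron hl,
    totalVar_plateau hl (by rw [Φ_neg_β]; exact (Φ_β_pos hD₂ hσ).le), Φ_neg_β]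
  simp

/-- Minimizers have energy at most `3 Φ(β)` once the parameter is small. -/
lemma IsMinimizer.energy_le (hD₂ : 0 ≤ D₂) (hσ : 0 < σ) (hl : 0 < l) (D₁ : ℝ) :
    ∃ ε₀ > 0, ∀ ε, 0 < ε → ε < ε₀ → ∀ θ g : ℝ → ℝ, IsMinimizer D₁ D₂ σ l ε θ g →
      F D₁ D₂ σ l ε θ g ≤ 3 * Φ D₂ σ (β D₂ σ) := by
  obtain ⟨ε₀, h0, h⟩ := exists_competitor hD₂ hσ hl (Φ_β_pos hD₂ hσ) D₁
  refine ⟨ε₀, h0, fun ε hε hlt θ g hmin => ?_⟩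
  obtain ⟨T, P, hY, hF⟩ := h ε hε hlt
  have := hmin.2 T P
  rw [G, G, if_pos hmin.1, if_pos hY, EReal.coe_le_coe_iff] at this
  linarith

lemma eLpNorm_one_eq_translateDist (hl : 0 < l) (b c : ℝ) (hT : Continuous T) :
    eLpNorm (fun x => T (x + c) - chevron l b x) 1 (volume.restrict (I l)) =
      ENNReal.ofReal (translateDist l b T c) := by
  have hTc : Continuous fun t => T (t + c) := hT.comp (by fun_prop)
  have hi : IntegrableOn (fun x => T (x + c) - chevron l b x) (I l) :=
    (integrableOn_I hl).2 ((hTc.intervalIntegrable _ _).sub (intervalIntegrable_of_bdd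
      (measurable_chevron l b) (fun x => (abs_chevron l b x).le) _ _))
  rw [eLpNorm_one_eq_lintegral_enorm, ← ofReal_integral_norm_eq_lintegral_enorm hi, translateDist,
    ← setIntegral_I hl]
  rfl

lemma perExt_comp_add_ae_eq {u U : ℝ → ℝ} (hl : 0 < l) (hU : Function.Periodic U (2 * l))
    (h : u =ᵐ[volume.restrict (I l)] U) (c : ℝ) :
    (fun x => perExt l u (x + c)) =ᵐ[volume.restrict (I l)] fun x => U (x + c) :=
  ae_restrict_of_ae ((measurePreserving_add_right volume c).quasiMeasurePreserving.ae
    (perExt_ae_eq hl hU h))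

end

/-- Minimizers converge, up to translation, to the profile with two equal plateaus. -/
theorem tendsto_of_isMinimizer (D₁ D₂ σ l : ℝ) (hD₁ : 0 ≤ D₁) (hD₂ : 0 ≤ D₂) (hσ : 0 < σ) (hl : 0 < l) :
    ∀ (ε : ℕ → ℝ) (θ g : ℕ → ℝ → ℝ), (∀ j, 0 < ε j) → Tendsto ε atTop (𝓝 0) →
      (∀ j, IsMinimizer D₁ D₂ σ l (ε j) (θ j) (g j)) →
      ∃ (g_lim : ℝ → ℝ) (a c : ℕ → ℝ),
        (∀ j, a j = 1 ∨ a j = -1) ∧ (∀ j, c j ∈ Ioo (-l) l) ∧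
        Tendsto (fun j => eLpNorm
          (fun x => a j * perExt l (θ j) (x + c j)
            - chevron l (β D₂ σ) x)
          1 (volume.restrict (I l))) atTop (𝓝 0) ∧
        Tendsto (fun j => eLpNorm
          (fun x => a j * (perExt l (g j) (x + c j) - mean l (g j))
            - g_lim x)
          2 (volume.restrict (I l))) atTop (𝓝 0) ∧
        MemA D₂ σ l (chevron l (β D₂ σ)) g_lim ∧
        G₀ D₂ σ l (chevron l (β D₂ σ)) g_lim
          = ENNReal.ofReal (2 * Φ D₂ σ (β D₂ σ)) := by
  intro ε θ g hε hε0 hmin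
  choose T T' P P' P'' hrep hθT hgP hF using fun j => (hmin j).1.exists_isRep hl
  choose c hc hcmin using fun j : ℕ =>
    exists_almost_min hl (β D₂ σ) (T j) (ν := 1 / ((j : ℝ) + 1)) (by positivity)
  set Q : ℕ → ℝ := fun j => translateDist l (β D₂ σ) (T j) (c j) with hQ
  set Y : ℕ → ℝ := fun j => ∫ x in (-l)..l, |P' j x + Real.sin (T j x)| with hY
  have hQ0 : ∀ j, 0 ≤ Q j := fun j => intervalIntegral.integral_nonneg (by linarith) fun _ _ => abs_nonneg _
  have hY0 : ∀ j, 0 ≤ Y j := fun j => intervalIntegral.integral_nonneg (by linarith) fun _ _ => abs_nonneg _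
  have hsmall : ∀ κ > 0, ∀ᶠ j in atTop, Q j < κ ∧ Y j < κ := by
    intro κ hκ
    obtain ⟨ε₀, h0, hen⟩ := IsMinimizer.energy_le hD₂ hσ hl D₁
    obtain ⟨ε₁, h1, hnear⟩ := exists_translateDist_lt hD₁ hD₂ hσ hl (half_pos hκ)
    filter_upwards [hε0.eventually_lt_const h0, hε0.eventually_lt_const h1,
      (tendsto_one_div_add_atTop_nhds_zero_nat (𝕜 := ℝ)).eventually_lt_const (half_pos hκ)] with j e0 e1 e2
    have hE := hen (ε j) (hε j) e0 (θ j) (g j) (hmin j)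
    rw [hF j] at hE
    obtain ⟨⟨m, hm⟩, hy⟩ := hnear (ε j) (hε j) e1 _ _ _ _ _ (hrep j) hE
    obtain ⟨c', hc', hlt⟩ := exists_mem_translateDist_lt hl (β D₂ σ) (hrep j).primT.continuous
      (hrep j).bound (hrep j).perT hm
    have := hcmin j c' hc'
    exact ⟨by simp only [hQ]; linarith, by simp only [hY]; linarith⟩
  have hQt : Tendsto Q atTop (𝓝 0) := tendsto_order.2
    ⟨fun a ha => Eventually.of_forall fun j => ha.trans_le (hQ0 j),
      fun κ hκ => (hsmall κ hκ).mono fun _ h => h.1⟩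
  have hYt : Tendsto Y atTop (𝓝 0) := tendsto_order.2
    ⟨fun a ha => Eventually.of_forall fun j => ha.trans_le (hY0 j),
      fun κ hκ => (hsmall κ hκ).mono fun _ h => h.2⟩
  refine ⟨glim l (β D₂ σ), fun _ => 1, c, fun _ => Or.inl rfl, hc, ?_, ?_, memA_chevron hl,
    G₀_chevron hD₂ hσ hl⟩
  · have h1 : Tendsto (fun j => ENNReal.ofReal (Q j)) atTop (𝓝 0) := by
      simpa using ENNReal.tendsto_ofReal hQt
    refine h1.congr fun j => ?_
    rw [hQ, ← eLpNorm_one_eq_translateDist hl _ _ (hrep j).primT.continuous]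
    refine eLpNorm_congr_ae ?_
    filter_upwards [perExt_comp_add_ae_eq hl (hrep j).perT (hθT j) (c j)] with x hx
    rw [hx, one_mul]
  · have h1 : Tendsto (fun j => (volume.restrict (I l)) univ ^ (2 : ℝ≥0∞).toReal⁻¹ *
        ENNReal.ofReal (Q j + Y j)) atTop (𝓝 0) := by
      have h2 : Tendsto (fun j => ENNReal.ofReal (Q j + Y j)) atTop (𝓝 0) := by
        simpa using ENNReal.tendsto_ofReal (hQt.add hYt)
      have h3 := ENNReal.Tendsto.const_mul (a := (volume.restrict (I l)) univ ^ (2 : ℝ≥0∞).toReal⁻¹) h2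
        (Or.inr (ENNReal.rpow_ne_top_of_nonneg (by positivity) (by simp [I])))
      rwa [mul_zero] at h3
    refine tendsto_of_tendsto_of_tendsto_of_le_of_le tendsto_const_nhds h1 (fun _ => zero_le) fun j => ?_
    refine eLpNorm_le_of_ae_bound ?_
    have hmean : mean l (g j) = mean l (P j) := by
      rw [mean, mean, integral_congr_ae (hgP j)]
    filter_upwards [perExt_comp_add_ae_eq hl (hrep j).perP (hgP j) (c j),
      ae_restrict_mem (measurableSet_Ioo : MeasurableSet (I l))] with x hx hxI
    rw [hx, one_mul, hmean, Real.norm_eq_abs]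
    exact (hrep j).abs_sub_glim_le hl le_rfl (Ioo_subset_Icc_self hxI)

end ChenLubensky

theorem theorem3p1 (D₁ D₂ σ l : ℝ) (hD₁ : 0 ≤ D₁) (hD₂ : 0 ≤ D₂) (hσ : 0 < σ) (hl : 0 < l) :
    -- `W` is nonnegative and `±β` are its zeros in `[-π, π]`
    (0 < ChenLubensky.β D₂ σ ∧ ∀ t ∈ Icc (-Real.pi) Real.pi, 0 ≤ ChenLubensky.W D₂ σ t ∧
      (ChenLubensky.W D₂ σ t = 0 ↔ t = ChenLubensky.β D₂ σ ∨ t = -ChenLubensky.β D₂ σ)) ∧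
    ∀ (ε : ℕ → ℝ) (θ g : ℕ → ℝ → ℝ), (∀ j, 0 < ε j) → Tendsto ε atTop (𝓝 0) →
      (∀ j, ChenLubensky.IsMinimizer D₁ D₂ σ l (ε j) (θ j) (g j)) →
      ∃ (g_lim : ℝ → ℝ) (a c : ℕ → ℝ),
        (∀ j, a j = 1 ∨ a j = -1) ∧ (∀ j, c j ∈ Ioo (-l) l) ∧
        Tendsto (fun j => eLpNorm
          (fun x => a j * ChenLubensky.perExt l (θ j) (x + c j)
            - ChenLubensky.chevron l (ChenLubensky.β D₂ σ) x)
          1 (volume.restrict (ChenLubensky.I l))) atTop (𝓝 0) ∧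
        Tendsto (fun j => eLpNorm
          (fun x => a j * (ChenLubensky.perExt l (g j) (x + c j) - ChenLubensky.mean l (g j))
            - g_lim x)
          2 (volume.restrict (ChenLubensky.I l))) atTop (𝓝 0) ∧
        ChenLubensky.MemA D₂ σ l (ChenLubensky.chevron l (ChenLubensky.β D₂ σ)) g_lim ∧
        ChenLubensky.G₀ D₂ σ l (ChenLubensky.chevron l (ChenLubensky.β D₂ σ)) g_lim
          = ENNReal.ofReal (2 * ChenLubensky.Φ D₂ σ (ChenLubensky.β D₂ σ)) := by
  obtain ⟨hβ0, -, hβz⟩ := ChenLubensky.β_spec hD₂ hσ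
  exact ⟨⟨hβ0, fun t ht => ⟨ChenLubensky.W_nonneg hD₂ hσ t, hβz t ht⟩⟩,
    ChenLubensky.tendsto_of_isMinimizer D₁ D₂ σ l hD₁ hD₂ hσ hl⟩
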